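/- Let $k$ be a real quadratic field with ring of integers $\mathcal O$, let $\mathfrak f\neq\mathcal O$ be an integral ideal of $\mathcal O$ with $\mathfrak f\cap\mathbb Z=f\mathbb Z$, $f\in\mathbb Z_{>0}$, let $I$ be a (nonzero) fractional ideal of $k$ and let $\xi$ be a character of the additive group of $I$, with values in the complex roots of unity, whose annihilator $\{a\in\mathcal O:\xi(ax)=1\ \forall x\in I\}$ equals $\mathfrak f$. Let $\mu_f\subset\mathbb C$ be the group of $f$-th roots of unity. Let $\tau_1,\tau_2\in I$ be totally positive, linearly independent over $\mathbb Q$, and such that $\xi(\tau_1)\neq1$ and $\xi(\tau_2)\neq1$, and let $A\in I/(\mathbb Z\tau_1+\mathbb Z\tau_2)$. Put $$P=\{\lambda\tau_1+\mu\tau_2:\lambda,\mu\in\mathbb Q,\ 0<\lambda\le1,\ 0\le\mu<1\},\qquad C=\{\lambda\tau_1+\mu\tau_2:\lambda,\mu\in\mathbb Q,\ 0<\lambda,\ 0\le\mu\},$$ and let $\tilde a$ be the unique element of $A\cap P$. Let $\underline\iota=(\iota_1,\iota_2)$ denote the two embeddings of $k$ into $\mathbb R$, in either order, and put $$z(s;\xi,A,\tau_1,\tau_2)=\sum_{a\in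 A\cap C}\frac{\xi(a)}{(\iota_1(a)\iota_2(a))^{s}},$$ which does not depend on the order. For $u=(u_1,u_2)\in\mathbb R^2$ write $(1+X)^{u}=(1+X_1)^{u_1}(1+X_2)^{u_2}$ for the product of formal binomial series. Put $$F_{\underline\iota}(X)=\frac{\xi(\tilde a)(1+X)^{\underline\iota(\tilde a)}}{(1-\xi(\tau_1)(1+X)^{\underline\iota(\tau_1)})(1-\xi(\tau_2)(1+X)^{\underline\iota(\tau_2)})}\in\mathbb C[[X_1,X_2]],\qquad \Delta=(1+X_1)(1+X_2)\frac{\partial^2}{\partial X_1\partial X_2}.$$ Then: (i) the series $z(s;\xi,A,\tau_1,\tau_2)$ converges absolutely for $\Re(s)>1$ to an analytic function, which has a meromorphic continuation to $\mathbb C$; (ii) for each integer $m\le0$ this continuation is analytic at $m$ and, for either choice of $\underline\iota$, its value at $m$ is the constant term of $\Delta^{-m}F_{\underline\iota}(X)$; (iii) for each integer $m\le0$ the value $z(m;\xi,A,\tau_1,\tau_2)$ lies in $\mathbb Q(\mu_f)$. -/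

import Mathlib

open NumberField

noncomputable section

namespace ConeZeta

section Characters

variable {k : Type*} [Field k] {J : Submodule (𝓞 k) k}

/-- The annihilator of an additive character `ξ` of `J`: the ideal of all `a ∈ 𝓞 k`
such that `ξ (a x) = 1` for every `x ∈ J`. -/
def annihilator (ξ : AddChar J ℂ) : Ideal (𝓞 k) where
  carrier := {a | ∀ x : J, ξ (a • x) = 1}
  zero_mem' := fun x => by rw [zero_smul, AddChar.map_zero_eq_one]
  add_mem' := fun {a b} ha hb x => by
    rw [add_smul, AddChar.map_add_eq_mul, ha x, hb x, one_mul]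
  smul_mem' := fun c a ha x => by
    rw [smul_eq_mul, mul_comm, mul_smul]; exact ha (c • x)

/-- `(ξ, I)` is a pair in `W_𝔣`: `I` is a (nonzero) fractional ideal and `ξ` is a character of
the additive group of `I`, with values in the complex roots of unity and annihilator `𝔣`. -/
structure IsCharacterPair (𝔣 : Ideal (𝓞 k)) (I : FractionalIdeal (nonZeroDivisors (𝓞 k)) k)
    (ξ : AddChar (I : Submodule (𝓞 k) k) ℂ) : Prop where
  ne_zero : I ≠ 0
  finite_order : ∀ x, IsOfFinOrder (ξ x)
  annihilator_eq : annihilator ξ = 𝔣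

end Characters

/-- The field `ℚ(μ_f)`, inside `ℂ`. -/
def cyclotomicSubfield (f : ℕ) : IntermediateField ℚ ℂ :=
  IntermediateField.adjoin ℚ {z : ℂ | z ^ f = 1}

section Cones

variable {k : Type*} [Field k]

/-- `x` is totally positive: all the real embeddings of `k` take a positive value at `x`. -/
def IsTotallyPos (x : k) : Prop := ∀ σ : k →+* ℝ, 0 < σ x

/-- The half-open parallelogram `P(τ₁, τ₂)`. -/
def parallelogram [CharZero k] (τ₁ τ₂ : k) : Set k :=
  {x | ∃ l m : ℚ, 0 < l ∧ l ≤ 1 ∧ 0 ≤ m ∧ m < 1 ∧ x = l • τ₁ + m • τ₂}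

/-- The half-open cone `C(τ₁, τ₂)`. -/
def cone [CharZero k] (τ₁ τ₂ : k) : Set k :=
  {x | ∃ l m : ℚ, 0 < l ∧ 0 ≤ m ∧ x = l • τ₁ + m • τ₂}

/-- The subgroup `ℤτ₁ + ℤτ₂` of `J`. -/
def lattice {J : Submodule (𝓞 k) k} (τ₁ τ₂ : J) : AddSubgroup J :=
  AddSubgroup.zmultiples τ₁ ⊔ AddSubgroup.zmultiples τ₂

/-- The representative `ã` of a class `A ∈ J / (ℤτ₁ + ℤτ₂)` in `P(τ₁, τ₂)`. It exists and is
unique by `existsUnique_representative` below. -/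
def representative [CharZero k] {J : Submodule (𝓞 k) k} (τ₁ τ₂ : J) (A : J ⧸ lattice τ₁ τ₂) : J :=
  Classical.epsilon fun a : J =>
    (QuotientAddGroup.mk a : J ⧸ lattice τ₁ τ₂) = A ∧ (a : k) ∈ parallelogram (τ₁ : k) (τ₂ : k)

theorem existsUnique_representative [NumberField k] [Algebra.IsQuadraticExtension ℚ k]
    {J : Submodule (𝓞 k) k} (τ₁ τ₂ : J) (hτ : LinearIndependent ℚ ![(τ₁ : k), (τ₂ : k)])
    (A : J ⧸ lattice τ₁ τ₂) :
    ∃! a : J, (QuotientAddGroup.mk a : J ⧸ lattice τ₁ τ₂) = A ∧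
      (a : k) ∈ parallelogram (τ₁ : k) (τ₂ : k) := by
  obtain ⟨x, rfl⟩ := QuotientAddGroup.mk_surjective A
  have hcoord : ∀ y : k, ∃ l m : ℚ, y = l • (τ₁ : k) + m • (τ₂ : k) := by
    intro y
    let b := basisOfLinearIndependentOfCardEqFinrank hτ
      (by simp [Algebra.IsQuadraticExtension.finrank_eq_two ℚ k])
    refine ⟨b.repr y 0, b.repr y 1, ?_⟩
    conv_lhs => rw [← b.sum_repr y]
    simp [b, Fin.sum_univ_two]
  have hinj : ∀ l m : ℚ, l • (τ₁ : k) + m • (τ₂ : k) = 0 → l = 0 ∧ m = 0 :=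
    LinearIndependent.pair_iff.mp hτ
  obtain ⟨l, m, hx⟩ := hcoord x
  refine ⟨x - ((⌈l⌉ - 1 : ℤ) • τ₁ + (⌊m⌋ : ℤ) • τ₂), ⟨?_, ?_⟩, ?_⟩
  · rw [QuotientAddGroup.eq]
    have : -(x - ((⌈l⌉ - 1 : ℤ) • τ₁ + (⌊m⌋ : ℤ) • τ₂)) + x
        = (⌈l⌉ - 1 : ℤ) • τ₁ + (⌊m⌋ : ℤ) • τ₂ := by abel
    rw [this]
    exact AddSubgroup.add_mem_sup (AddSubgroup.zsmul_mem_zmultiples _ _)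
      (AddSubgroup.zsmul_mem_zmultiples _ _)
  · refine ⟨l - (⌈l⌉ - 1), m - ⌊m⌋, ?_, ?_, ?_, ?_, ?_⟩
    · have := Int.ceil_lt_add_one l; linarith
    · have := Int.le_ceil l; linarith
    · have := Int.floor_le m; linarith
    · have := Int.lt_floor_add_one m; linarith
    · push_cast
      rw [hx]
      simp only [Algebra.smul_def]
      push_cast
      simp
      ring
  · rintro y ⟨hy, l', m', h1, h2, h3, h4, h5⟩
    rw [QuotientAddGroup.eq, lattice, AddSubgroup.mem_sup] at hy
    obtain ⟨u, hu, v, hv, huv⟩ := hy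
    obtain ⟨p, rfl⟩ := AddSubgroup.mem_zmultiples_iff.mp hu
    obtain ⟨q, rfl⟩ := AddSubgroup.mem_zmultiples_iff.mp hv
    have hyx : y = x - (p • τ₁ + q • τ₂) := by rw [huv]; abel
    have hk : (y : k) = (x : k) - (p • (τ₁ : k) + q • (τ₂ : k)) := by
      rw [hyx]; push_cast; rfl
    obtain ⟨e1, e2⟩ := hinj (l' - l + p) (m' - m + q) (by
      have := hk.symm.trans h5
      rw [hx] at this
      simp only [Algebra.smul_def, map_add, map_sub, map_intCast] at this ⊢
      linear_combination -this)
    have hp : ⌈l⌉ - 1 = p := by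
      have : ⌈l⌉ = p + 1 := by
        rw [Int.ceil_eq_iff]; push_cast; constructor <;> linarith
      omega
    have hq : ⌊m⌋ = q := by
      rw [Int.floor_eq_iff]; constructor <;> linarith
    rw [hp, hq, hyx]

/-- The term `ξ(a) / (ι₁(a) ι₂(a))^s`; the product is over all the real embeddings of `k`, of which
there are exactly two when `k` is real quadratic. -/
def zetaTerm [NumberField k] {J : Submodule (𝓞 k) k} (ξ : AddChar J ℂ) (s : ℂ) (a : J) : ℂ :=
  ξ a / ((∏ σ : k →+* ℝ, σ (a : k) : ℝ) : ℂ) ^ s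

/-- The index set `A ∩ C(τ₁, τ₂)`. -/
def coneClass [CharZero k] {J : Submodule (𝓞 k) k} (τ₁ τ₂ : J) (A : J ⧸ lattice τ₁ τ₂) : Set J :=
  {a | (QuotientAddGroup.mk a : J ⧸ lattice τ₁ τ₂) = A ∧ (a : k) ∈ cone (τ₁ : k) (τ₂ : k)}

/-- The series `z(s; ξ, A, τ₁, τ₂)`. -/
def coneZeta [NumberField k] {J : Submodule (𝓞 k) k} (ξ : AddChar J ℂ) (τ₁ τ₂ : J)
    (A : J ⧸ lattice τ₁ τ₂) (s : ℂ) : ℂ :=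
  ∑' a : coneClass τ₁ τ₂ A, zetaTerm ξ s (a : J)

end Cones

section PowerSeriesPart

/-- The product `(1 + X₁)^{u₁} (1 + X₂)^{u₂}` of two formal binomial series: the coefficient of
`X₁^{n₁} X₂^{n₂}` is the product of the binomial coefficients `choose uᵢ nᵢ`. -/
def binomialPower (u : Fin 2 → ℝ) : MvPowerSeries (Fin 2) ℂ :=
  fun n => ((Ring.choose (u 0) (n 0) * Ring.choose (u 1) (n 1) : ℝ) : ℂ)

/-- The differential operator `Δ = (1 + X₁)(1 + X₂) ∂²/∂X₁∂X₂`. -/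
def Delta (G : MvPowerSeries (Fin 2) ℂ) : MvPowerSeries (Fin 2) ℂ :=
  (1 + MvPowerSeries.X 0) * (1 + MvPowerSeries.X 1) *
    MvPowerSeries.pderiv ℂ 0 (MvPowerSeries.pderiv ℂ 1 G)

variable {k : Type*} [Field k]

/-- The power series `F_ι(X; ξ, A, τ₁, τ₂)`, where `ι = (ι 0, ι 1)`. The constant term of the
denominator is `(1 - ξ τ₁)(1 - ξ τ₂)`, so that the denominator is invertible
when `ξ τ₁ ≠ 1` and `ξ τ₂ ≠ 1`. -/
def coneSeries [CharZero k] {J : Submodule (𝓞 k) k} (ι : Fin 2 → k →+* ℝ) (ξ : AddChar J ℂ)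
    (τ₁ τ₂ : J) (A : J ⧸ lattice τ₁ τ₂) : MvPowerSeries (Fin 2) ℂ :=
  MvPowerSeries.C (ξ (representative τ₁ τ₂ A)) *
      binomialPower (fun i => ι i (representative τ₁ τ₂ A : k)) *
    ((1 - MvPowerSeries.C (ξ τ₁) * binomialPower (fun i => ι i (τ₁ : k))) *
      (1 - MvPowerSeries.C (ξ τ₂) * binomialPower (fun i => ι i (τ₂ : k))))⁻¹

end PowerSeriesPart

end ConeZeta

end

/-! Write `α` for the representative of `A` in the parallelogram. The points of `A` in the cone are
exactly `α + m τ₁ + n τ₂` with `m, n ∈ ℕ`. Writing each power of the norm as a product of two Gamma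
integrals and summing two geometric series gives, for `Re s > 1`, that `Γ(s)² z(s)` is the Mellin
transform at `(s, s)` of `G(t) = ξ(α) e^{-⟨α,t⟩} / ((1 - ξ(τ₁) e^{-⟨τ₁,t⟩}) (1 - ξ(τ₂)
e^{-⟨τ₂,t⟩}))`. The numbers `ξ(τⱼ)` have modulus `1` and differ from `1`, so no denominator vanishes
on the closed quadrant, the origin included; `G` and its derivatives are continuous there and decay
exponentially. Integration by parts in both variables (`exists_entire_mellin`) continues `z` to an
entire function whose value at `-n` is `(∂₁∂₂)ⁿ G (0)`.

Formally `1 + Xᵢ = e^{-tᵢ}` turns `-∂/∂tᵢ` into `(1 + Xᵢ) ∂/∂Xᵢ`, hence `∂₁∂₂` into `Δ`. No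
substitution is carried out. Both the power series and the function have the form `h · P(g₁, g₂)`,
with `h` an exponential, `gⱼ` geometric series and `P` a polynomial; in both settings
differentiation replaces `P` by the same `eulerOp` of `P` (`derivation_mul_aeval`,
`hasDerivAt_mul_eval`), and the value at the origin is `P` at the numbers `1 / (1 - ξ(τⱼ))`.

For rationality, the two Euler operators are conjugate, so the coefficients of their composite are
norms and polar forms of the norm (`map_normOp`). The polynomials `P` therefore have rational
coefficients and do not depend on the order of the embeddings, and they are evaluated at elements of
`ℚ(μ_f)`. -/

noncomputable section

namespace ConeZeta

/-! ### Euler operators on polynomials in two geometric series. -/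

section EulerOperators

open MvPolynomial

variable {R S : Type*} [CommRing R] [CommRing S]

/-- The derivation `(Xⱼ² - Xⱼ) ∂/∂Xⱼ` of `R[X₀, X₁]`. It describes the effect of the Euler operator
`w d/dw` on polynomials in `1 / (1 - w)`. -/
def geomDerivation (j : Fin 2) : Derivation R (MvPolynomial (Fin 2) R) (MvPolynomial (Fin 2) R) :=
  ((X j : MvPolynomial (Fin 2) R) ^ 2 - X j) • pderiv j

theorem geomDerivation_apply (j : Fin 2) (P : MvPolynomial (Fin 2) R) :
    geomDerivation j P = (X j ^ 2 - X j) * pderiv j P := rfl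

/-- The commutator of two derivations is a derivation, so it suffices that it kills the variables.
-/
theorem geomDerivation_comm (P : MvPolynomial (Fin 2) R) :
    geomDerivation 0 (geomDerivation 1 P) = geomDerivation 1 (geomDerivation 0 P) := by
  have h : ⁅(geomDerivation 0 : Derivation R (MvPolynomial (Fin 2) R) (MvPolynomial (Fin 2) R)),
      (geomDerivation 1 : Derivation R (MvPolynomial (Fin 2) R) (MvPolynomial (Fin 2) R))⁆ = 0 := by
    apply derivation_ext
    intro i
    rw [Derivation.commutator_apply]
    fin_cases i <;> simp [geomDerivation_apply, pderiv_X]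
  have := congrArg (fun D => D P) h
  rw [Derivation.commutator_apply] at this
  exact sub_eq_zero.mp this

theorem map_geomDerivation (φ : R →+* S) (j : Fin 2) (P : MvPolynomial (Fin 2) R) :
    map φ (geomDerivation j P) = geomDerivation j (map φ P) := by
  simp [geomDerivation_apply, pderiv_map]

/-- The operator on `P ∈ R[X₀, X₁]` which corresponds to an Euler operator acting on `h P(g₀, g₁)`,
where `h` is homogeneous of weight `c₀` and `gⱼ = 1 / (1 - wⱼ)` with `w₀`, `w₁` of weights
`c₁`, `c₂`. -/
def eulerOp (c₀ c₁ c₂ : R) (P : MvPolynomial (Fin 2) R) : MvPolynomial (Fin 2) R :=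
  C c₀ * P + C c₁ * geomDerivation 0 P + C c₂ * geomDerivation 1 P

/-- A second order operator with constant coefficients in the derivations `geomDerivation`. -/
def quadraticOp (a b₀ b₁ d₀ e d₁ : R) (P : MvPolynomial (Fin 2) R) : MvPolynomial (Fin 2) R :=
  C a * P + C b₀ * geomDerivation 0 P + C b₁ * geomDerivation 1 P +
    C d₀ * geomDerivation 0 (geomDerivation 0 P) + C e * geomDerivation 0 (geomDerivation 1 P) +
    C d₁ * geomDerivation 1 (geomDerivation 1 P)

/-- The coefficients are symmetric under exchanging the triples `c` and `d`; for conjugate triples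
this makes them rational. -/
theorem eulerOp_eulerOp (c₀ c₁ c₂ d₀ d₁ d₂ : R) (P : MvPolynomial (Fin 2) R) :
    eulerOp c₀ c₁ c₂ (eulerOp d₀ d₁ d₂ P) =
      quadraticOp (c₀ * d₀) (c₀ * d₁ + c₁ * d₀) (c₀ * d₂ + c₂ * d₀) (c₁ * d₁)
        (c₁ * d₂ + c₂ * d₁) (c₂ * d₂) P := by
  simp only [eulerOp, quadraticOp, map_add, map_mul, Derivation.leibniz, smul_eq_mul,
    derivation_C, geomDerivation_comm]
  ring

theorem map_quadraticOp (φ : R →+* S) (a b₀ b₁ d₀ e d₁ : R) (P : MvPolynomial (Fin 2) R) :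
    map φ (quadraticOp a b₀ b₁ d₀ e d₁ P) =
      quadraticOp (φ a) (φ b₀) (φ b₁) (φ d₀) (φ e) (φ d₁) (map φ P) := by
  simp [quadraticOp, map_geomDerivation]

/-- If `g = 1 / (1 - w)` and `D w = c w`, then `D g = c (g² - g)`; the chain rule thus keeps
polynomials in such `g` stable under `D`. -/
theorem derivation_mul_aeval {T : Type*} [CommRing T] [Algebra R T] (D : Derivation R T T)
    {h g₀ g₁ : T} {c₀ c₁ c₂ : R} (hh : D h = c₀ • h) (h₀ : D g₀ = c₁ • (g₀ ^ 2 - g₀))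
    (h₁ : D g₁ = c₂ • (g₁ ^ 2 - g₁)) (P : MvPolynomial (Fin 2) R) :
    D (h * aeval ![g₀, g₁] P) = h * aeval ![g₀, g₁] (eulerOp c₀ c₁ c₂ P) := by
  have key : D (aeval ![g₀, g₁] P) =
      aeval ![g₀, g₁] (C c₁ * geomDerivation 0 P + C c₂ * geomDerivation 1 P) := by
    induction P using MvPolynomial.induction_on with
    | C a => simp [derivation_C]
    | add p q hp hq => simp only [map_add, hp, hq, mul_add]; ring
    | mul_X p i hp =>
      rw [map_mul, Derivation.leibniz, hp]
      fin_cases i <;>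
        simp [geomDerivation_apply, pderiv_X, h₀, h₁, Algebra.smul_def] <;> ring
  rw [Derivation.leibniz, key, hh, eulerOp]
  simp only [map_add, map_mul, smul_eq_mul, aeval_C, Algebra.smul_def]
  ring

end EulerOperators

/-! ### The power series side: iterates of `Δ` and their constant terms. -/

section FormalSeries

open MvPowerSeries

theorem coeff_binomialPower (u : Fin 2 → ℝ) (n : Fin 2 →₀ ℕ) :
    coeff n (binomialPower u) =
      ((Ring.choose (u 0) (n 0) * Ring.choose (u 1) (n 1) : ℝ) : ℂ) := rfl

theorem constantCoeff_binomialPower (u : Fin 2 → ℝ) : constantCoeff (binomialPower u) = 1 := by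
  rw [← coeff_zero_eq_constantCoeff_apply, coeff_binomialPower]
  simp

/-- The Euler derivation `(1 + Xᵢ) ∂/∂Xᵢ` of `ℂ⟦X₀, X₁⟧`. -/
def eulerDerivation (i : Fin 2) :
    Derivation ℂ (MvPowerSeries (Fin 2) ℂ) (MvPowerSeries (Fin 2) ℂ) :=
  (1 + X i : MvPowerSeries (Fin 2) ℂ) • pderiv ℂ i

theorem eulerDerivation_apply (i : Fin 2) (G : MvPowerSeries (Fin 2) ℂ) :
    eulerDerivation i G = (1 + X i) * pderiv ℂ i G := rfl

theorem Delta_eq (G : MvPowerSeries (Fin 2) ℂ) :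
    Delta G = eulerDerivation 0 (eulerDerivation 1 G) := by
  rw [eulerDerivation_apply 1, Derivation.leibniz, eulerDerivation_apply, eulerDerivation_apply,
    Delta]
  have : pderiv ℂ (0 : Fin 2) (1 + X 1 : MvPowerSeries (Fin 2) ℂ) = 0 := by
    rw [map_add, Derivation.map_one_eq_zero, pderiv_X_of_ne (by decide), add_zero]
  rw [this, smul_eq_mul, smul_eq_mul]
  ring

theorem choose_recurrence (u : ℝ) (n : ℕ) :
    (n + 1 : ℝ) * Ring.choose u (n + 1) = (u - n) * Ring.choose u n := by
  have := Ring.choose_smul_choose u (Nat.le_succ n)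
  rw [Nat.succ_eq_add_one, Nat.add_sub_cancel_left, Ring.choose_one_right, Nat.choose_succ_self_right,
    nsmul_eq_mul] at this
  push_cast at this
  linarith

theorem eulerDerivation_binomialPower (i : Fin 2) (u : Fin 2 → ℝ) :
    eulerDerivation i (binomialPower u) = (u i : ℂ) • binomialPower u := by
  ext n
  -- `Xᵢ ∂/∂Xᵢ` multiplies the coefficient at `n` by `n i`; exponents with `n i = 0` are treated
  -- apart because the shift back by one is truncated there.
  have hX : coeff n (X i * pderiv ℂ i (binomialPower u)) = n i * coeff n (binomialPower u) := by
    rw [X, coeff_monomial_mul, one_mul]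
    split_ifs with h
    · rw [coeff_pderiv, tsub_add_cancel_of_le h, mul_comm]
      have h1 : 1 ≤ n i := by simpa using h i
      simp [Nat.cast_sub h1]
    · have h0 : n i = 0 := by
        by_contra h0
        exact h (Finsupp.single_le_iff.mpr (Nat.one_le_iff_ne_zero.mpr h0))
      simp [h0]
  rw [eulerDerivation_apply, add_mul, one_mul, map_add, hX, coeff_pderiv, coeff_smul]
  have key : ((n i : ℝ) + 1) * Ring.choose (u i) (n i + 1) + n i * Ring.choose (u i) (n i) =
      u i * Ring.choose (u i) (n i) := by
    rw [choose_recurrence]; ring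
  have keyC := congrArg (fun r : ℝ => (r : ℂ)) key
  simp only [Complex.ofReal_add, Complex.ofReal_mul, Complex.ofReal_one,
    Complex.ofReal_natCast] at keyC
  fin_cases i
  · simp [coeff_binomialPower] at keyC ⊢
    linear_combination ((Ring.choose (u 1) (n 1) : ℝ) : ℂ) * keyC
  · simp [coeff_binomialPower] at keyC ⊢
    linear_combination ((Ring.choose (u 0) (n 0) : ℝ) : ℂ) * keyC

/-- The geometric series `1 / (1 - ζ (1 + X)^u)`. -/
def geomSeries (ζ : ℂ) (u : Fin 2 → ℝ) : MvPowerSeries (Fin 2) ℂ :=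
  (1 - C ζ * binomialPower u)⁻¹

theorem constantCoeff_geomSeries (ζ : ℂ) (u : Fin 2 → ℝ) :
    constantCoeff (geomSeries ζ u) = (1 - ζ)⁻¹ := by
  simp [geomSeries, constantCoeff_inv, constantCoeff_binomialPower]

/-- Obtained by differentiating the identity `g (1 - ζ (1 + X)^u) = 1`. -/
theorem eulerDerivation_geomSeries (i : Fin 2) {ζ : ℂ} (hζ : ζ ≠ 1) (u : Fin 2 → ℝ) :
    eulerDerivation i (geomSeries ζ u) =
      (u i : ℂ) • (geomSeries ζ u ^ 2 - geomSeries ζ u) := by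
  have hc : constantCoeff (1 - C ζ * binomialPower u) ≠ 0 := by
    simpa [constantCoeff_binomialPower, sub_eq_zero] using hζ.symm
  have hinv : geomSeries ζ u * (1 - C ζ * binomialPower u) = 1 :=
    MvPowerSeries.inv_mul_cancel _ hc
  have hd : eulerDerivation i (1 - C ζ * binomialPower u) =
      -((u i : ℂ) • (C ζ * binomialPower u)) := by
    rw [map_sub, Derivation.map_one_eq_zero, Derivation.leibniz, eulerDerivation_binomialPower,
      eulerDerivation_apply i (C ζ), pderiv_C, mul_zero, smul_zero, add_zero, zero_sub,
      smul_eq_mul, mul_smul_comm]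
  rw [Derivation.leibniz_of_mul_eq_one _ hinv, hd]
  simp only [smul_eq_C_mul, smul_eq_mul]
  linear_combination -(C (u i : ℂ) * geomSeries ζ u) * hinv

/-- The power series attached to a polynomial `P` in the two geometric series. -/
def formalSum (x τ₁ τ₂ : Fin 2 → ℝ) (ζ₁ ζ₂ : ℂ) (P : MvPolynomial (Fin 2) ℂ) :
    MvPowerSeries (Fin 2) ℂ :=
  binomialPower x * MvPolynomial.aeval ![geomSeries ζ₁ τ₁, geomSeries ζ₂ τ₂] P

variable {ζ₁ ζ₂ : ℂ} (x τ₁ τ₂ : Fin 2 → ℝ)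

theorem eulerDerivation_formalSum (h₁ : ζ₁ ≠ 1) (h₂ : ζ₂ ≠ 1) (i : Fin 2)
    (P : MvPolynomial (Fin 2) ℂ) :
    eulerDerivation i (formalSum x τ₁ τ₂ ζ₁ ζ₂ P) =
      formalSum x τ₁ τ₂ ζ₁ ζ₂ (eulerOp (x i : ℂ) (τ₁ i : ℂ) (τ₂ i : ℂ) P) :=
  derivation_mul_aeval _ (eulerDerivation_binomialPower i x) (eulerDerivation_geomSeries i h₁ τ₁)
    (eulerDerivation_geomSeries i h₂ τ₂) P

theorem Delta_formalSum (h₁ : ζ₁ ≠ 1) (h₂ : ζ₂ ≠ 1) (P : MvPolynomial (Fin 2) ℂ) :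
    Delta (formalSum x τ₁ τ₂ ζ₁ ζ₂ P) = formalSum x τ₁ τ₂ ζ₁ ζ₂
      (eulerOp (x 0 : ℂ) (τ₁ 0 : ℂ) (τ₂ 0 : ℂ) (eulerOp (x 1 : ℂ) (τ₁ 1 : ℂ) (τ₂ 1 : ℂ) P)) := by
  rw [Delta_eq, eulerDerivation_formalSum x τ₁ τ₂ h₁ h₂, eulerDerivation_formalSum x τ₁ τ₂ h₁ h₂]

theorem Delta_C_mul (c : ℂ) (G : MvPowerSeries (Fin 2) ℂ) : Delta (C c * G) = C c * Delta G := by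
  rw [← smul_eq_C_mul, ← smul_eq_C_mul, Delta_eq, Delta_eq, Derivation.map_smul,
    Derivation.map_smul]

theorem iterate_Delta_formalSum (h₁ : ζ₁ ≠ 1) (h₂ : ζ₂ ≠ 1) (c : ℂ)
    (P : MvPolynomial (Fin 2) ℂ) (n : ℕ) :
    Delta^[n] (C c * formalSum x τ₁ τ₂ ζ₁ ζ₂ P) = C c * formalSum x τ₁ τ₂ ζ₁ ζ₂
      ((eulerOp (x 0 : ℂ) (τ₁ 0 : ℂ) (τ₂ 0 : ℂ) ∘ eulerOp (x 1 : ℂ) (τ₁ 1 : ℂ) (τ₂ 1 : ℂ))^[n]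
        P) := by
  induction n with
  | zero => rfl
  | succ n ih =>
    rw [Function.iterate_succ_apply', ih, Delta_C_mul, Delta_formalSum x τ₁ τ₂ h₁ h₂,
      Function.iterate_succ_apply', Function.comp_apply]

theorem constantCoeff_formalSum (P : MvPolynomial (Fin 2) ℂ) :
    constantCoeff (formalSum x τ₁ τ₂ ζ₁ ζ₂ P) =
      MvPolynomial.eval ![(1 - ζ₁)⁻¹, (1 - ζ₂)⁻¹] P := by
  rw [formalSum, map_mul, constantCoeff_binomialPower, one_mul]
  induction P using MvPolynomial.induction_on with
  | C a => simp [MvPowerSeries.algebraMap_apply]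
  | add p q hp hq => rw [map_add, map_add, map_add, hp, hq]
  | mul_X p i hp =>
    rw [map_mul, map_mul, map_mul, hp]
    fin_cases i <;> simp [constantCoeff_geomSeries]

end FormalSeries

/-! ### Mellin transforms in two variables and their continuation. -/

section Mellin

open MeasureTheory Set Filter Topology

/-- A function which is holomorphic in a parameter and locally dominated by an integrable function
has a holomorphic integral. -/
theorem differentiableAt_integral_of_dominated {α : Type*} [MeasurableSpace α] {μ : Measure α}
    {F : ℂ → α → ℂ} {s₀ : ℂ} {r : ℝ} (hr : 0 < r) {bound : α → ℝ}
    (hmeas : ∀ s ∈ Metric.ball s₀ (2 * r), AEStronglyMeasurable (F s) μ)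
    (hdiff : ∀ᵐ a ∂μ, ∀ s ∈ Metric.ball s₀ (2 * r), DifferentiableAt ℂ (F · a) s)
    (hbound : ∀ᵐ a ∂μ, ∀ s ∈ Metric.ball s₀ (2 * r), ‖F s a‖ ≤ bound a)
    (hint : Integrable bound μ) :
    DifferentiableAt ℂ (fun s => ∫ a, F s a ∂μ) s₀ := by
  have h₀ : s₀ ∈ Metric.ball s₀ (2 * r) := Metric.mem_ball_self (by linarith)
  have hsub : ∀ s ∈ Metric.ball s₀ r, Metric.closedBall s (r / 2) ⊆ Metric.ball s₀ (2 * r) := by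
    intro s hs z hz
    rw [Metric.mem_ball] at hs ⊢
    rw [Metric.mem_closedBall] at hz
    linarith [dist_triangle z s s₀]
  -- The derivative in the parameter is a pointwise limit of difference quotients along the steps `r
  -- / (n + 1)`, which stay inside the ball.
  have hmeas' : AEStronglyMeasurable (fun a => deriv (F · a) s₀) μ := by
    let u : ℕ → ℂ := fun n => ((r / (n + 1) : ℝ) : ℂ)
    have hu0 : ∀ n, u n ≠ 0 := fun n => by
      simp only [u, ne_eq, Complex.ofReal_eq_zero]; positivity
    have hu : Tendsto u atTop (𝓝 0) := by
      have : Tendsto (fun n : ℕ => r / ((n : ℝ) + 1)) atTop (𝓝 0) :=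
        tendsto_const_div_atTop_nhds_zero_nat r |>.comp (tendsto_add_atTop_nat 1) |>.congr
          fun n => by simp
      have h := (Complex.continuous_ofReal.tendsto 0).comp this
      rwa [Complex.ofReal_zero] at h
    have hmem : ∀ n, s₀ + u n ∈ Metric.ball s₀ (2 * r) := by
      intro n
      rw [Metric.mem_ball, dist_self_add_left, Complex.norm_real, Real.norm_eq_abs,
        abs_of_pos (by positivity)]
      have : r / ((n : ℝ) + 1) ≤ r := div_le_self hr.le (by linarith [n.cast_nonneg (α := ℝ)])
      linarith
    refine aestronglyMeasurable_of_tendsto_ae atTop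
      (f := fun n a => (u n)⁻¹ • (F (s₀ + u n) a - F s₀ a))
      (fun n => ((hmeas _ (hmem n)).sub (hmeas _ h₀)).const_smul (u n)⁻¹) ?_
    filter_upwards [hdiff] with a ha
    have := (hasDerivAt_iff_tendsto_slope_zero.mp (ha s₀ h₀).hasDerivAt).comp
      (tendsto_nhdsWithin_iff.mpr ⟨hu, Eventually.of_forall fun n => hu0 n⟩)
    exact this
  refine (hasDerivAt_integral_of_dominated_loc_of_deriv_le (F' := fun s a => deriv (F · a) s)
    (bound := fun a => bound a / (r / 2)) (Metric.ball_mem_nhds s₀ hr) ?_ ?_ hmeas' ?_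
    (hint.div_const _) ?_).2.differentiableAt
  · filter_upwards [Metric.ball_mem_nhds s₀ (by linarith : 0 < 2 * r)] with s hs using hmeas s hs
  · exact hint.mono' (hmeas _ h₀) (hbound.mono fun a ha => ha s₀ h₀)
  · filter_upwards [hdiff, hbound] with a ha hb s hs
    -- Cauchy's estimate on the circle of radius `r / 2` about `s` bounds the derivative by `bound a
    -- / (r / 2)`.
    refine Complex.norm_deriv_le_of_forall_mem_sphere_norm_le (by linarith) ?_ fun z hz =>
      hb z (hsub s hs (Metric.sphere_subset_closedBall hz))
    refine DifferentiableOn.diffContOnCl fun z hz => ?_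
    rw [closure_ball _ (by linarith)] at hz
    exact (ha z (hsub s hs hz)).differentiableWithinAt
  · filter_upwards [hdiff] with a ha s hs
    exact (ha s (hsub s hs (Metric.mem_closedBall_self (by linarith)))).hasDerivAt

/-- Continuity and exponential decay on the closed positive quadrant. -/
structure HasExpDecay (φ : ℝ × ℝ → ℂ) : Prop where
  continuousOn : ContinuousOn φ (Ici 0 ×ˢ Ici 0)
  exists_bound : ∃ C c : ℝ, 0 < c ∧
    ∀ a b : ℝ, 0 ≤ a → 0 ≤ b → ‖φ (a, b)‖ ≤ C * (Real.exp (-c * a) * Real.exp (-c * b))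

/-- Lebesgue measure on the open positive quadrant. -/
def quadrant : Measure (ℝ × ℝ) :=
  (volume.restrict (Ioi (0 : ℝ))).prod (volume.restrict (Ioi (0 : ℝ)))

instance : SFinite quadrant := by unfold quadrant; infer_instance

/-- The integrand of the Mellin transform in two variables. -/
def mellinKernel (φ : ℝ × ℝ → ℂ) (s₁ s₂ : ℂ) (t : ℝ × ℝ) : ℂ :=
  (t.1 : ℂ) ^ (s₁ - 1) * (t.2 : ℂ) ^ (s₂ - 1) * φ t

/-- The Mellin transform in two variables. -/
def doubleMellin (φ : ℝ × ℝ → ℂ) (s₁ s₂ : ℂ) : ℂ := ∫ t, mellinKernel φ s₁ s₂ t ∂quadrant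

theorem ae_quadrant {p : ℝ × ℝ → Prop} (h : ∀ a b : ℝ, 0 < a → 0 < b → p (a, b)) :
    ∀ᵐ t ∂quadrant, p t := by
  rw [quadrant, Measure.prod_restrict]
  filter_upwards [ae_restrict_mem (measurableSet_Ioi.prod measurableSet_Ioi)] with t ht
  exact h t.1 t.2 ht.1 ht.2

theorem aestronglyMeasurable_mellinKernel {φ : ℝ × ℝ → ℂ} (hφ : HasExpDecay φ) (s₁ s₂ : ℂ) :
    AEStronglyMeasurable (mellinKernel φ s₁ s₂) quadrant := by
  rw [quadrant, Measure.prod_restrict]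
  refine ContinuousOn.aestronglyMeasurable ?_ (measurableSet_Ioi.prod measurableSet_Ioi)
  refine (ContinuousOn.mul ?_ ?_).mul
    (hφ.continuousOn.mono (prod_mono Ioi_subset_Ici_self Ioi_subset_Ici_self))
  · exact ContinuousOn.cpow_const (by fun_prop) fun t ht => Or.inl (by simpa using ht.1)
  · exact ContinuousOn.cpow_const (by fun_prop) fun t ht => Or.inl (by simpa using ht.2)

theorem integrableOn_rpow_mul_exp {σ c : ℝ} (hσ : 0 < σ) (hc : 0 < c) :
    IntegrableOn (fun a : ℝ => a ^ (σ - 1) * Real.exp (-c * a)) (Ioi 0) := by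
  simpa using integrableOn_rpow_mul_exp_neg_mul_rpow (p := 1) (s := σ - 1) (by linarith)
    zero_lt_one hc

theorem norm_mellinKernel_le {φ : ℝ × ℝ → ℂ} {C c : ℝ}
    (h : ∀ a b : ℝ, 0 ≤ a → 0 ≤ b → ‖φ (a, b)‖ ≤ C * (Real.exp (-c * a) * Real.exp (-c * b)))
    (s₁ s₂ : ℂ) {a b : ℝ} (ha : 0 < a) (hb : 0 < b) :
    ‖mellinKernel φ s₁ s₂ (a, b)‖ ≤ C * ((a ^ (s₁.re - 1) * Real.exp (-c * a)) *
      (b ^ (s₂.re - 1) * Real.exp (-c * b))) := by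
  rw [mellinKernel, norm_mul, norm_mul, Complex.norm_cpow_eq_rpow_re_of_pos ha,
    Complex.norm_cpow_eq_rpow_re_of_pos hb]
  have h' := h a b ha.le hb.le
  have : 0 ≤ a ^ (s₁.re - 1) * b ^ (s₂.re - 1) := by positivity
  calc _ ≤ a ^ (s₁.re - 1) * b ^ (s₂.re - 1) * (C * (Real.exp (-c * a) * Real.exp (-c * b))) :=
        mul_le_mul_of_nonneg_left h' this
    _ = _ := by ring

theorem integrable_mellinKernel {φ : ℝ × ℝ → ℂ} (hφ : HasExpDecay φ) {s₁ s₂ : ℂ}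
    (h₁ : 0 < s₁.re) (h₂ : 0 < s₂.re) : Integrable (mellinKernel φ s₁ s₂) quadrant := by
  obtain ⟨C, c, hc, h⟩ := hφ.exists_bound
  refine Integrable.mono' (((integrableOn_rpow_mul_exp h₁ hc).mul_prod
    (integrableOn_rpow_mul_exp h₂ hc)).const_mul C)
    (aestronglyMeasurable_mellinKernel hφ s₁ s₂) ?_
  exact ae_quadrant fun a b ha hb => norm_mellinKernel_le h s₁ s₂ ha hb

theorem differentiableAt_doubleMellin {φ : ℝ × ℝ → ℂ} (hφ : HasExpDecay φ) {s : ℂ}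
    (hs : 0 < s.re) : DifferentiableAt ℂ (fun s => doubleMellin φ s s) s := by
  obtain ⟨C, c, hc, h⟩ := hφ.exists_bound
  have hC : 0 ≤ C := by simpa using (norm_nonneg _).trans (h 0 0 le_rfl le_rfl)
  -- Since `Re s = 2p`, the ball of radius `p` about `s` lies in the strip `p ≤ Re z ≤ 3p`. There
  -- the power of `a` is at most the sum of its values at the two edges, which gives the integrable
  -- majorant `B`.
  set p := s.re / 2 with hp
  have hp0 : 0 < p := by positivity
  let B : ℝ → ℝ := fun a => a ^ (p - 1) * Real.exp (-c * a) + a ^ (3 * p - 1) * Real.exp (-c * a)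
  have hB : IntegrableOn B (Ioi 0) := (integrableOn_rpow_mul_exp hp0 hc).add
    (integrableOn_rpow_mul_exp (by positivity) hc)
  have hre : ∀ z ∈ Metric.ball s (2 * (p / 2)), p ≤ z.re ∧ z.re ≤ 3 * p := by
    intro z hz
    rw [Metric.mem_ball, Complex.dist_eq] at hz
    have := (abs_lt.mp ((Complex.abs_re_le_norm (z - s)).trans_lt hz))
    rw [Complex.sub_re] at this
    constructor <;> linarith [this.1, this.2]
  have hpow : ∀ z ∈ Metric.ball s (2 * (p / 2)), ∀ a : ℝ, 0 < a →
      a ^ (z.re - 1) * Real.exp (-c * a) ≤ B a := by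
    intro z hz a ha
    simp only [B]
    rw [← add_mul]
    refine mul_le_mul_of_nonneg_right ?_ (Real.exp_pos _).le
    obtain ⟨h1, h2⟩ := hre z hz
    rcases le_total a 1 with h | h
    · exact (Real.rpow_le_rpow_of_exponent_ge ha h (by linarith)).trans
        (le_add_of_nonneg_right (by positivity))
    · exact (Real.rpow_le_rpow_of_exponent_le h (by linarith)).trans
        (le_add_of_nonneg_left (by positivity))
  refine differentiableAt_integral_of_dominated (r := p / 2)
    (bound := fun t => C * (B t.1 * B t.2)) (by positivity)
    (fun z _ => aestronglyMeasurable_mellinKernel hφ z z) ?_ ?_ ((hB.mul_prod hB).const_mul C)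
  · refine ae_quadrant fun a b ha hb z _ => ?_
    have ha' : (a : ℂ) ≠ 0 := by exact_mod_cast ha.ne'
    have hb' : (b : ℂ) ≠ 0 := by exact_mod_cast hb.ne'
    unfold mellinKernel
    exact ((DifferentiableAt.const_cpow (by fun_prop) (Or.inl ha')).mul
      (DifferentiableAt.const_cpow (by fun_prop) (Or.inl hb'))).mul_const _
  · refine ae_quadrant fun a b ha hb z hz => ?_
    refine (norm_mellinKernel_le h z z ha hb).trans (mul_le_mul_of_nonneg_left ?_ hC)
    have hBa := hpow z hz a ha
    exact mul_le_mul hBa (hpow z hz b hb) (by positivity) (le_trans (by positivity) hBa)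

/-- Integration by parts for the Mellin transform of an exponentially decaying function. -/
theorem mul_integral_cpow_mul {v v' : ℝ → ℂ} {C C' c c' : ℝ} (hc : 0 < c) (hc' : 0 < c')
    (hv : ∀ a : ℝ, 0 ≤ a → HasDerivAt v (-v' a) a) (hv' : ContinuousOn v' (Ici 0))
    (hb : ∀ a : ℝ, 0 ≤ a → ‖v a‖ ≤ C * Real.exp (-c * a))
    (hb' : ∀ a : ℝ, 0 ≤ a → ‖v' a‖ ≤ C' * Real.exp (-c' * a)) {s : ℂ} (hs : 0 < s.re) :
    s * ∫ a in Ioi (0 : ℝ), (a : ℂ) ^ (s - 1) * v a = ∫ a in Ioi (0 : ℝ), (a : ℂ) ^ s * v' a := by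
  have hs0 : s ≠ 0 := fun h => by simp [h] at hs
  have hvc : ContinuousOn v (Ici 0) := fun a ha => (hv a ha).continuousAt.continuousWithinAt
  have hint : ∀ {w : ℝ → ℂ} {D d : ℝ} {z : ℂ}, 0 < d → 0 < z.re → ContinuousOn w (Ici 0) →
      (∀ a : ℝ, 0 ≤ a → ‖w a‖ ≤ D * Real.exp (-d * a)) →
      IntegrableOn (fun a : ℝ => (a : ℂ) ^ (z - 1) * w a) (Ioi 0) := by
    intro w D d z hd hz hw h
    refine Integrable.mono' ((integrableOn_rpow_mul_exp hz hd).const_mul D) ?_ ?_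
    · refine ContinuousOn.aestronglyMeasurable ?_ measurableSet_Ioi
      refine ContinuousOn.mul ?_ (hw.mono Ioi_subset_Ici_self)
      exact ContinuousOn.cpow_const (by fun_prop) fun t ht => Or.inl (by simpa using ht)
    · filter_upwards [ae_restrict_mem measurableSet_Ioi] with a ha
      rw [norm_mul, Complex.norm_cpow_eq_rpow_re_of_pos ha, Complex.sub_re, Complex.one_re]
      calc _ ≤ a ^ (z.re - 1) * (D * Real.exp (-d * a)) :=
            mul_le_mul_of_nonneg_left (h a (le_of_lt ha)) (Real.rpow_nonneg (le_of_lt ha) _)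
        _ = _ := by ring
  have hnorm : ∀ a : ℝ, 0 < a → ‖(a : ℂ) ^ s * v a‖ ≤ C * (a ^ s.re * Real.exp (-c * a)) := by
    intro a ha
    rw [norm_mul, Complex.norm_cpow_eq_rpow_re_of_pos ha]
    calc _ ≤ a ^ s.re * (C * Real.exp (-c * a)) :=
          mul_le_mul_of_nonneg_left (hb a ha.le) (Real.rpow_nonneg ha.le _)
      _ = _ := by ring
  -- As `v'` is minus the derivative of `v`, the signs cancel. The boundary terms vanish at `0`
  -- because `Re s > 0` and at infinity by exponential decay.
  have h := integral_Ioi_mul_deriv_eq_deriv_mul (a := 0) (a' := 0) (b' := 0)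
    (u := fun a : ℝ => (a : ℂ) ^ s) (u' := fun a : ℝ => s * (a : ℂ) ^ (s - 1))
    (v := v) (v' := fun a => -v' a) ?_ (fun a ha => hv a (le_of_lt ha)) ?_ ?_ ?_ ?_
  · simp only [mul_neg, integral_neg, mul_assoc, integral_const_mul] at h
    linear_combination h
  · exact fun a ha => hasDerivAt_ofReal_cpow_const (ne_of_gt ha) hs0
  · have := (hint (z := s + 1) hc' (by simp; linarith) hv' hb').neg
    refine this.congr_fun (fun a _ => ?_) measurableSet_Ioi
    simp
  · refine IntegrableOn.congr_fun ((hint hc hs hvc hb).const_mul s) (fun a _ => ?_) measurableSet_Ioi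
    simp [mul_assoc]
  · have hlim : Tendsto (fun a : ℝ => C * (a ^ s.re * Real.exp (-c * a))) (𝓝[>] 0) (𝓝 0) := by
      have : ContinuousAt (fun a : ℝ => C * (a ^ s.re * Real.exp (-c * a))) 0 :=
        continuousAt_const.mul ((Real.continuousAt_rpow_const 0 s.re (Or.inr hs.le)).mul
          (by fun_prop : ContinuousAt (fun a : ℝ => Real.exp (-c * a)) 0))
      have h := this.tendsto
      rw [Real.zero_rpow hs.ne', zero_mul, mul_zero] at h
      exact h.mono_left nhdsWithin_le_nhds
    refine squeeze_zero_norm' ?_ hlim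
    filter_upwards [self_mem_nhdsWithin] with a ha using hnorm a ha
  · have hlim : Tendsto (fun a : ℝ => C * (a ^ s.re * Real.exp (-c * a))) atTop (𝓝 0) := by
      simpa using (tendsto_rpow_mul_exp_neg_mul_atTop_nhds_zero s.re c hc).const_mul C
    refine squeeze_zero_norm' ?_ hlim
    filter_upwards [eventually_gt_atTop 0] with a ha using hnorm a ha

/-- The fundamental theorem of calculus for an exponentially decaying function. -/
theorem integral_Ioi_deriv_of_decay {v v' : ℝ → ℂ} {C C' c c' : ℝ} (hc : 0 < c) (hc' : 0 < c')
    (hv : ∀ a : ℝ, 0 ≤ a → HasDerivAt v (-v' a) a) (hv' : ContinuousOn v' (Ici 0))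
    (hb : ∀ a : ℝ, 0 ≤ a → ‖v a‖ ≤ C * Real.exp (-c * a))
    (hb' : ∀ a : ℝ, 0 ≤ a → ‖v' a‖ ≤ C' * Real.exp (-c' * a)) :
    ∫ a in Ioi (0 : ℝ), v' a = v 0 := by
  have hint : IntegrableOn v' (Ioi 0) := by
    refine Integrable.mono' ((integrableOn_exp_mul_Ioi (neg_lt_zero.mpr hc') 0).const_mul C')
      ((hv'.mono Ioi_subset_Ici_self).aestronglyMeasurable measurableSet_Ioi) ?_
    filter_upwards [ae_restrict_mem measurableSet_Ioi] with a ha using hb' a (le_of_lt ha)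
  have hlim : Tendsto v atTop (𝓝 0) := by
    have hexp : Tendsto (fun a : ℝ => C * Real.exp (-c * a)) atTop (𝓝 0) := by
      simpa using (Real.tendsto_exp_atBot.comp
        (tendsto_id.const_mul_atTop_of_neg (neg_lt_zero.mpr hc))).const_mul C
    refine squeeze_zero_norm' ?_ hexp
    filter_upwards [eventually_ge_atTop 0] with a ha using hb a ha
  have h := integral_Ioi_of_hasDerivAt_of_tendsto' (fun a ha => hv a ha) hint.neg hlim
  rw [integral_neg, zero_sub, neg_inj] at h
  exact h

/-- The exponential in the frozen variable is at most `1`, so one-variable bounds hold with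
constants uniform over the slices. -/
theorem HasExpDecay.exists_bound_slice {φ : ℝ × ℝ → ℂ} (hφ : HasExpDecay φ) :
    ∃ C c : ℝ, 0 < c ∧
      (∀ b : ℝ, 0 ≤ b → ∀ a : ℝ, 0 ≤ a → ‖φ (a, b)‖ ≤ C * Real.exp (-c * a)) ∧
      (∀ a : ℝ, 0 ≤ a → ∀ b : ℝ, 0 ≤ b → ‖φ (a, b)‖ ≤ C * Real.exp (-c * b)) := by
  obtain ⟨C, c, hc, h⟩ := hφ.exists_bound
  have hC : 0 ≤ C := by simpa using (norm_nonneg _).trans (h 0 0 le_rfl le_rfl)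
  have hle : ∀ a : ℝ, 0 ≤ a → Real.exp (-c * a) ≤ 1 := fun a ha =>
    Real.exp_le_one_iff.mpr (by nlinarith)
  refine ⟨C, c, hc, fun b hb a ha => (h a b ha hb).trans ?_, fun a ha b hb => (h a b ha hb).trans ?_⟩
  · exact mul_le_mul_of_nonneg_left (mul_le_of_le_one_right (Real.exp_pos _).le (hle b hb)) hC
  · exact mul_le_mul_of_nonneg_left (mul_le_of_le_one_left (Real.exp_pos _).le (hle a ha)) hC

theorem HasExpDecay.continuousOn_left {φ : ℝ × ℝ → ℂ} (hφ : HasExpDecay φ) {b : ℝ} (hb : 0 ≤ b) :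
    ContinuousOn (fun a => φ (a, b)) (Ici 0) :=
  hφ.continuousOn.comp (by fun_prop) fun _ ha => ⟨ha, hb⟩

theorem HasExpDecay.continuousOn_right {φ : ℝ × ℝ → ℂ} (hφ : HasExpDecay φ) {a : ℝ} (ha : 0 ≤ a) :
    ContinuousOn (fun b => φ (a, b)) (Ici 0) :=
  hφ.continuousOn.comp (by fun_prop) fun _ hb => ⟨ha, hb⟩

/-- Fubini with the first variable innermost, then integration by parts on each slice. -/
theorem mul_doubleMellin_left {φ ψ : ℝ × ℝ → ℂ} (hφ : HasExpDecay φ) (hψ : HasExpDecay ψ)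
    (h : ∀ a b : ℝ, 0 ≤ a → 0 ≤ b → HasDerivAt (fun a => φ (a, b)) (-ψ (a, b)) a)
    {s₁ s₂ : ℂ} (h₁ : 0 < s₁.re) (h₂ : 0 < s₂.re) :
    s₁ * doubleMellin φ s₁ s₂ = doubleMellin ψ (s₁ + 1) s₂ := by
  obtain ⟨C, c, hc, hb, -⟩ := hφ.exists_bound_slice
  obtain ⟨C', c', hc', hb', -⟩ := hψ.exists_bound_slice
  have h₁' : 0 < (s₁ + 1).re := by simp; linarith
  rw [doubleMellin, doubleMellin, quadrant, integral_prod_symm _ (integrable_mellinKernel hφ h₁ h₂),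
    integral_prod_symm _ (integrable_mellinKernel hψ h₁' h₂), ← integral_const_mul]
  refine setIntegral_congr_fun measurableSet_Ioi fun b hb0 => ?_
  have hb0' : (0 : ℝ) ≤ b := le_of_lt hb0
  have key := mul_integral_cpow_mul hc hc' (fun a ha => h a b ha hb0') (hψ.continuousOn_left hb0')
    (hb b hb0') (hb' b hb0') h₁
  calc s₁ * ∫ a in Ioi (0 : ℝ), mellinKernel φ s₁ s₂ (a, b)
      = (b : ℂ) ^ (s₂ - 1) * (s₁ * ∫ a in Ioi (0 : ℝ), (a : ℂ) ^ (s₁ - 1) * φ (a, b)) := by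
        rw [mul_left_comm, ← integral_const_mul ((b : ℂ) ^ (s₂ - 1))]
        congr 2
        funext a
        simp only [mellinKernel]
        ring
    _ = ∫ a in Ioi (0 : ℝ), mellinKernel ψ (s₁ + 1) s₂ (a, b) := by
        rw [key, ← integral_const_mul]
        congr 1
        funext a
        simp only [mellinKernel, add_sub_cancel_right]
        ring

theorem mul_doubleMellin_right {φ ψ : ℝ × ℝ → ℂ} (hφ : HasExpDecay φ) (hψ : HasExpDecay ψ)
    (h : ∀ a b : ℝ, 0 ≤ a → 0 ≤ b → HasDerivAt (fun b => φ (a, b)) (-ψ (a, b)) b)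
    {s₁ s₂ : ℂ} (h₁ : 0 < s₁.re) (h₂ : 0 < s₂.re) :
    s₂ * doubleMellin φ s₁ s₂ = doubleMellin ψ s₁ (s₂ + 1) := by
  obtain ⟨C, c, hc, -, hb⟩ := hφ.exists_bound_slice
  obtain ⟨C', c', hc', -, hb'⟩ := hψ.exists_bound_slice
  have h₂' : 0 < (s₂ + 1).re := by simp; linarith
  rw [doubleMellin, doubleMellin, quadrant, integral_prod _ (integrable_mellinKernel hφ h₁ h₂),
    integral_prod _ (integrable_mellinKernel hψ h₁ h₂'), ← integral_const_mul]
  refine setIntegral_congr_fun measurableSet_Ioi fun a ha0 => ?_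
  have ha0' : (0 : ℝ) ≤ a := le_of_lt ha0
  have key := mul_integral_cpow_mul hc hc' (fun b hb => h a b ha0' hb) (hψ.continuousOn_right ha0')
    (hb a ha0') (hb' a ha0') h₂
  calc s₂ * ∫ b in Ioi (0 : ℝ), mellinKernel φ s₁ s₂ (a, b)
      = (a : ℂ) ^ (s₁ - 1) * (s₂ * ∫ b in Ioi (0 : ℝ), (b : ℂ) ^ (s₂ - 1) * φ (a, b)) := by
        rw [mul_left_comm, ← integral_const_mul ((a : ℂ) ^ (s₁ - 1))]
        congr 2
        funext b
        simp only [mellinKernel]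
        ring
    _ = ∫ b in Ioi (0 : ℝ), mellinKernel ψ s₁ (s₂ + 1) (a, b) := by
        rw [key, ← integral_const_mul]
        congr 1
        funext b
        simp only [mellinKernel, add_sub_cancel_right]
        ring

/-- At exponent `1` the powers of `t` disappear, and the fundamental theorem of calculus applies in
each variable. -/
theorem doubleMellin_one_one {φ ψ χ : ℝ × ℝ → ℂ} (hφ : HasExpDecay φ) (hψ : HasExpDecay ψ)
    (hχ : HasExpDecay χ)
    (h₁ : ∀ a b : ℝ, 0 ≤ a → 0 ≤ b → HasDerivAt (fun a => φ (a, b)) (-ψ (a, b)) a)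
    (h₂ : ∀ a b : ℝ, 0 ≤ a → 0 ≤ b → HasDerivAt (fun b => ψ (a, b)) (-χ (a, b)) b) :
    doubleMellin χ 1 1 = φ (0, 0) := by
  obtain ⟨C, c, hc, hb, -⟩ := hφ.exists_bound_slice
  obtain ⟨C₁, c₁, hc₁, hb₁, hb₁'⟩ := hψ.exists_bound_slice
  obtain ⟨C₂, c₂, hc₂, -, hb₂⟩ := hχ.exists_bound_slice
  rw [doubleMellin, quadrant, integral_prod _ (integrable_mellinKernel hχ (by simp) (by simp))]
  simp only [mellinKernel, sub_self, Complex.cpow_zero, one_mul]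
  rw [← integral_Ioi_deriv_of_decay hc hc₁ (fun a ha => h₁ a 0 ha le_rfl)
    (hψ.continuousOn_left le_rfl) (hb 0 le_rfl) (hb₁ 0 le_rfl)]
  refine setIntegral_congr_fun measurableSet_Ioi fun a ha0 => ?_
  have ha0' : (0 : ℝ) ≤ a := le_of_lt ha0
  exact integral_Ioi_deriv_of_decay hc₁ hc₂ (fun b hb => h₂ a b ha0' hb)
    (hχ.continuousOn_right ha0') (hb₁' a ha0') (hb₂ a ha0')

/-- The Mellin transform of a function which decays exponentially together with its mixed
derivatives, divided by `Γ(s)²`, extends to an entire function, whose values at the integers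
`-n ≤ 0` are the mixed derivatives at the origin. -/
theorem exists_entire_mellin {φ ψ : ℕ → ℝ × ℝ → ℂ} (hφ : ∀ k, HasExpDecay (φ k))
    (hψ : ∀ k, HasExpDecay (ψ k))
    (h₁ : ∀ k, ∀ a b : ℝ, 0 ≤ a → 0 ≤ b →
      HasDerivAt (fun a => φ k (a, b)) (-ψ k (a, b)) a)
    (h₂ : ∀ k, ∀ a b : ℝ, 0 ≤ a → 0 ≤ b →
      HasDerivAt (fun b => ψ k (a, b)) (-φ (k + 1) (a, b)) b) :
    ∃ Z : ℂ → ℂ, Differentiable ℂ Z ∧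
      (∀ s : ℂ, 0 < s.re → Complex.Gamma s ^ 2 * Z s = doubleMellin (φ 0) s s) ∧
      ∀ n : ℕ, Z (-n) = φ n (0, 0) := by
  -- `W k` is the continuation to `Re s > -k` after `k` integrations by parts in each variable; the
  -- relation `Γ(z + 1) = z Γ(z)` makes consecutive ones agree on the common domain.
  let W : ℕ → ℂ → ℂ := fun k s =>
    doubleMellin (φ k) (s + k) (s + k) * (Complex.Gamma (s + k))⁻¹ ^ 2
  have hstep : ∀ (k : ℕ) (s : ℂ), 0 < s.re + k → W k s = W (k + 1) s := by
    intro k s hs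
    have hre : 0 < (s + k).re := by simpa using hs
    have hre' : 0 < (s + k + 1).re := by rw [Complex.add_re, Complex.one_re]; linarith
    have hne : s + k ≠ 0 := fun h => by simp [h] at hre
    have e := mul_doubleMellin_left (hφ k) (hψ k) (h₁ k) hre hre
    have e' := mul_doubleMellin_right (hψ k) (hφ (k + 1)) (h₂ k) hre' hre
    simp only [W, Nat.cast_add, Nat.cast_one, ← add_assoc]
    rw [Complex.Gamma_add_one _ hne, ← e', ← e]
    field_simp
  have hindep : ∀ (k j : ℕ) (s : ℂ), 0 < s.re + k → W k s = W (k + j) s := by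
    intro k j s hs
    induction j with
    | zero => rfl
    | succ j ih =>
      rw [ih, hstep (k + j) s (by push_cast; linarith [j.cast_nonneg (α := ℝ)]), add_assoc]
  have hindep' : ∀ (k j : ℕ) (s : ℂ), 0 < s.re + k → 0 < s.re + j → W k s = W j s := by
    intro k j s hk hj
    rw [hindep k j s hk, hindep j k s hj, add_comm]
  have hdiff : ∀ (k : ℕ) (s : ℂ), 0 < s.re + k → DifferentiableAt ℂ (W k) s := by
    intro k s hs
    have hre : 0 < (s + k).re := by simpa using hs
    refine DifferentiableAt.mul ?_ (DifferentiableAt.pow ?_ 2)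
    · exact DifferentiableAt.comp (f := fun s : ℂ => s + k)
        (g := fun s => doubleMellin (φ k) s s) s (differentiableAt_doubleMellin (hφ k) hre)
        (by fun_prop)
    · exact (Complex.differentiable_one_div_Gamma (s + k)).comp s
        (f := fun s : ℂ => s + k) (by fun_prop)
  -- A level admissible at `s`: the natural floor is `0` when `Re s ≥ 0`, and the level `1` still
  -- works there.
  have hceil : ∀ s : ℂ, 0 < s.re + (⌊-s.re⌋₊ + 1 : ℕ) := by
    intro s
    have := Nat.lt_floor_add_one (-s.re)
    push_cast
    linarith
  refine ⟨fun s => W (⌊-s.re⌋₊ + 1) s, fun s => ?_, fun s hs => ?_, fun n => ?_⟩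
  · refine (hdiff _ s (hceil s)).congr_of_eventuallyEq ?_
    have hopen : ∀ᶠ z : ℂ in 𝓝 s, 0 < z.re + (⌊-s.re⌋₊ + 1 : ℕ) :=
      (continuous_const.continuousAt).eventually_lt
        ((Complex.continuous_re.add continuous_const).continuousAt) (hceil s)
    filter_upwards [hopen] with z hz using hindep' _ _ z (hceil z) hz
  · simp only
    rw [hindep' _ 0 s (hceil s) (by simpa using hs)]
    have := Complex.Gamma_ne_zero_of_re_pos hs
    simp only [W, Nat.cast_zero, add_zero]
    field_simp
  · simp only
    -- Level `n + 1` shifts the argument `-n` to `1`, where `Γ` equals `1`.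
    rw [hindep' _ (n + 1) (-n) (hceil _) (by simp)]
    have : (-n + (n + 1 : ℕ) : ℂ) = 1 := by push_cast; ring
    simp only [W, this, Complex.Gamma_one, inv_one, one_pow, mul_one]
    exact doubleMellin_one_one (hφ n) (hψ n) (hφ (n + 1)) (h₁ n) (h₂ n)

end Mellin

/-! ### The analytic generating function and the Dirichlet series. -/

section ExponentialSeries

open MeasureTheory Set Filter Topology

/-- Taking norms in `ζ r = 1` forces `r = 1`, hence `ζ = 1`. The case `r = 1` is the origin `t = 0`,
so `ζ ≠ 1` is what excludes a pole there. -/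
theorem one_sub_mul_ne_zero {ζ : ℂ} (hζ : ‖ζ‖ = 1) (hζ' : ζ ≠ 1) {r : ℝ} (hr : r ∈ Icc (0 : ℝ) 1) :
    1 - ζ * r ≠ 0 := by
  intro h
  have h1 : ζ * r = 1 := (sub_eq_zero.mp h).symm
  have hr1 : r = 1 := by
    have := congrArg norm h1
    rwa [norm_mul, hζ, one_mul, Complex.norm_real, norm_one, Real.norm_eq_abs,
      abs_of_nonneg hr.1] at this
  exact hζ' (by simpa [hr1] using h1)

/-- The exponential `exp (-⟨u, t⟩)`. -/
def weight (u : Fin 2 → ℝ) (t : ℝ × ℝ) : ℝ := Real.exp (-(u 0 * t.1 + u 1 * t.2))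

theorem weight_mem_Icc {u : Fin 2 → ℝ} (hu : ∀ i, 0 < u i) {t : ℝ × ℝ} (h₁ : 0 ≤ t.1)
    (h₂ : 0 ≤ t.2) : weight u t ∈ Icc (0 : ℝ) 1 :=
  ⟨(Real.exp_pos _).le, Real.exp_le_one_iff.mpr (neg_nonpos.mpr
    (add_nonneg (mul_nonneg (hu 0).le h₁) (mul_nonneg (hu 1).le h₂)))⟩

theorem weight_lt_one {u : Fin 2 → ℝ} (hu : ∀ i, 0 < u i) {t : ℝ × ℝ} (h₁ : 0 < t.1)
    (h₂ : 0 < t.2) : weight u t < 1 := by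
  rw [weight, ← Real.exp_zero, Real.exp_lt_exp]
  exact neg_lt_zero.mpr (add_pos (mul_pos (hu 0) h₁) (mul_pos (hu 1) h₂))

theorem hasDerivAt_weight_left (u : Fin 2 → ℝ) (a b : ℝ) :
    HasDerivAt (fun a => (weight u (a, b) : ℂ)) (-(u 0 * weight u (a, b))) a := by
  have h : HasDerivAt (fun a => weight u (a, b)) (weight u (a, b) * -(u 0 * 1)) a :=
    ((((hasDerivAt_id a).const_mul (u 0)).add_const (u 1 * b)).neg).exp
  refine h.ofReal_comp.congr_deriv ?_
  push_cast
  ring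

theorem hasDerivAt_weight_right (u : Fin 2 → ℝ) (a b : ℝ) :
    HasDerivAt (fun b => (weight u (a, b) : ℂ)) (-(u 1 * weight u (a, b))) b := by
  have h : HasDerivAt (fun b => weight u (a, b)) (weight u (a, b) * -(u 1 * 1)) b :=
    ((((hasDerivAt_id b).const_mul (u 1)).const_add (u 0 * a)).neg).exp
  refine h.ofReal_comp.congr_deriv ?_
  push_cast
  ring

theorem hasDerivAt_inv_one_sub {w : ℝ → ℂ} {a : ℝ} {c ζ : ℂ} (hw : HasDerivAt w (-(c * w a)) a)
    (h : 1 - ζ * w a ≠ 0) :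
    HasDerivAt (fun a => (1 - ζ * w a)⁻¹)
      (-(c * ((1 - ζ * w a)⁻¹ ^ 2 - (1 - ζ * w a)⁻¹))) a := by
  refine (((hw.const_mul ζ).const_sub 1).inv h).congr_deriv ?_
  field_simp
  ring

/-- Analytic counterpart of `derivation_mul_aeval`: the exponentials are `e^{-⟨u,t⟩}`, so `-d/dt`
plays the role of the Euler derivation. -/
theorem hasDerivAt_mul_eval {h g₀ g₁ : ℝ → ℂ} {a : ℝ} {c₀ c₁ c₂ : ℂ}
    (hh : HasDerivAt h (-(c₀ * h a)) a) (h₀ : HasDerivAt g₀ (-(c₁ * (g₀ a ^ 2 - g₀ a))) a)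
    (h₁ : HasDerivAt g₁ (-(c₂ * (g₁ a ^ 2 - g₁ a))) a) (P : MvPolynomial (Fin 2) ℂ) :
    HasDerivAt (fun a => h a * MvPolynomial.eval ![g₀ a, g₁ a] P)
      (-(h a * MvPolynomial.eval ![g₀ a, g₁ a] (eulerOp c₀ c₁ c₂ P))) a := by
  have key : HasDerivAt (fun a => MvPolynomial.eval ![g₀ a, g₁ a] P)
      (-(c₁ * MvPolynomial.eval ![g₀ a, g₁ a] (geomDerivation 0 P) +
        c₂ * MvPolynomial.eval ![g₀ a, g₁ a] (geomDerivation 1 P))) a := by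
    induction P using MvPolynomial.induction_on with
    | C z => simpa [MvPolynomial.derivation_C] using hasDerivAt_const a z
    | add p q hp hq =>
      simp only [map_add]
      exact (hp.add hq).congr_deriv (by ring)
    | mul_X p i hp =>
      fin_cases i
      · simp only [map_mul, MvPolynomial.eval_X]
        refine (hp.mul h₀).congr_deriv ?_
        simp [geomDerivation_apply, MvPolynomial.pderiv_X]
        ring
      · simp only [map_mul, MvPolynomial.eval_X]
        refine (hp.mul h₁).congr_deriv ?_
        simp [geomDerivation_apply, MvPolynomial.pderiv_X]
        ring
  refine (hh.mul key).congr_deriv ?_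
  simp only [eulerOp, map_add, map_mul, MvPolynomial.eval_C]
  ring

/-- The function `exp (-⟨x, t⟩) P(g₁, g₂)` with `gⱼ = 1 / (1 - ζⱼ exp (-⟨τⱼ, t⟩))`. -/
def exponentialSum (x τ₁ τ₂ : Fin 2 → ℝ) (ζ₁ ζ₂ : ℂ) (P : MvPolynomial (Fin 2) ℂ) (t : ℝ × ℝ) : ℂ :=
  weight x t *
    MvPolynomial.eval ![(1 - ζ₁ * weight τ₁ t)⁻¹, (1 - ζ₂ * weight τ₂ t)⁻¹] P

variable {x τ₁ τ₂ : Fin 2 → ℝ} {ζ₁ ζ₂ : ℂ}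

theorem exponentialSum_zero (P : MvPolynomial (Fin 2) ℂ) :
    exponentialSum x τ₁ τ₂ ζ₁ ζ₂ P (0, 0) =
      MvPolynomial.eval ![(1 - ζ₁)⁻¹, (1 - ζ₂)⁻¹] P := by
  simp [exponentialSum, weight]

theorem hasDerivAt_exponentialSum_left (h₁ : ∀ i, 0 < τ₁ i) (h₂ : ∀ i, 0 < τ₂ i)
    (hζ₁ : ‖ζ₁‖ = 1) (hζ₁' : ζ₁ ≠ 1) (hζ₂ : ‖ζ₂‖ = 1) (hζ₂' : ζ₂ ≠ 1)
    (P : MvPolynomial (Fin 2) ℂ) {a b : ℝ} (ha : 0 ≤ a) (hb : 0 ≤ b) :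
    HasDerivAt (fun a => exponentialSum x τ₁ τ₂ ζ₁ ζ₂ P (a, b))
      (-exponentialSum x τ₁ τ₂ ζ₁ ζ₂ (eulerOp (x 0 : ℂ) (τ₁ 0 : ℂ) (τ₂ 0 : ℂ) P) (a, b)) a :=
  hasDerivAt_mul_eval (hasDerivAt_weight_left x a b)
    (hasDerivAt_inv_one_sub (hasDerivAt_weight_left τ₁ a b)
      (one_sub_mul_ne_zero hζ₁ hζ₁' (weight_mem_Icc h₁ ha hb)))
    (hasDerivAt_inv_one_sub (hasDerivAt_weight_left τ₂ a b)
      (one_sub_mul_ne_zero hζ₂ hζ₂' (weight_mem_Icc h₂ ha hb))) P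

theorem hasDerivAt_exponentialSum_right (h₁ : ∀ i, 0 < τ₁ i) (h₂ : ∀ i, 0 < τ₂ i)
    (hζ₁ : ‖ζ₁‖ = 1) (hζ₁' : ζ₁ ≠ 1) (hζ₂ : ‖ζ₂‖ = 1) (hζ₂' : ζ₂ ≠ 1)
    (P : MvPolynomial (Fin 2) ℂ) {a b : ℝ} (ha : 0 ≤ a) (hb : 0 ≤ b) :
    HasDerivAt (fun b => exponentialSum x τ₁ τ₂ ζ₁ ζ₂ P (a, b))
      (-exponentialSum x τ₁ τ₂ ζ₁ ζ₂ (eulerOp (x 1 : ℂ) (τ₁ 1 : ℂ) (τ₂ 1 : ℂ) P) (a, b)) b :=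
  hasDerivAt_mul_eval (hasDerivAt_weight_right x a b)
    (hasDerivAt_inv_one_sub (hasDerivAt_weight_right τ₁ a b)
      (one_sub_mul_ne_zero hζ₁ hζ₁' (weight_mem_Icc h₁ ha hb)))
    (hasDerivAt_inv_one_sub (hasDerivAt_weight_right τ₂ a b)
      (one_sub_mul_ne_zero hζ₂ hζ₂' (weight_mem_Icc h₂ ha hb))) P

/-- The polynomial factor is a continuous function of the two weights, which range over the compact
square `[0,1]²`, hence is bounded; all the decay comes from the factor `weight x`. -/
theorem hasExpDecay_exponentialSum (hx : ∀ i, 0 < x i) (h₁ : ∀ i, 0 < τ₁ i) (h₂ : ∀ i, 0 < τ₂ i)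
    (hζ₁ : ‖ζ₁‖ = 1) (hζ₁' : ζ₁ ≠ 1) (hζ₂ : ‖ζ₂‖ = 1) (hζ₂' : ζ₂ ≠ 1)
    (P : MvPolynomial (Fin 2) ℂ) : HasExpDecay (exponentialSum x τ₁ τ₂ ζ₁ ζ₂ P) := by
  let H : ℝ × ℝ → ℂ := fun r =>
    MvPolynomial.eval ![(1 - ζ₁ * r.1)⁻¹, (1 - ζ₂ * r.2)⁻¹] P
  have hH : ContinuousOn H (Icc 0 1 ×ˢ Icc 0 1) := by
    have c₁ : ContinuousOn (fun r : ℝ × ℝ => (1 - ζ₁ * r.1)⁻¹) (Icc 0 1 ×ˢ Icc 0 1) :=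
      ContinuousOn.inv₀ (by fun_prop) fun r hr => one_sub_mul_ne_zero hζ₁ hζ₁' hr.1
    have c₂ : ContinuousOn (fun r : ℝ × ℝ => (1 - ζ₂ * r.2)⁻¹) (Icc 0 1 ×ˢ Icc 0 1) :=
      ContinuousOn.inv₀ (by fun_prop) fun r hr => one_sub_mul_ne_zero hζ₂ hζ₂' hr.2
    have c : ContinuousOn (fun r : ℝ × ℝ => ![(1 - ζ₁ * r.1)⁻¹, (1 - ζ₂ * r.2)⁻¹])
        (Icc 0 1 ×ˢ Icc 0 1) := by
      refine continuousOn_pi.mpr fun i => ?_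
      fin_cases i
      · exact c₁
      · exact c₂
    exact (MvPolynomial.continuous_eval P).comp_continuousOn c
  have hw : ∀ u : Fin 2 → ℝ, Continuous (weight u) := fun u => by unfold weight; fun_prop
  have hmaps : MapsTo (fun t => (weight τ₁ t, weight τ₂ t)) (Ici (0 : ℝ) ×ˢ Ici (0 : ℝ))
      (Icc 0 1 ×ˢ Icc 0 1) := fun t ht =>
    ⟨weight_mem_Icc h₁ ht.1 ht.2, weight_mem_Icc h₂ ht.1 ht.2⟩
  have hcomp : ContinuousOn (fun t => H (weight τ₁ t, weight τ₂ t)) (Ici 0 ×ˢ Ici 0) :=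
    hH.comp ((hw τ₁).prodMk (hw τ₂)).continuousOn hmaps
  have heq : exponentialSum x τ₁ τ₂ ζ₁ ζ₂ P =
      fun t => (weight x t : ℂ) * H (weight τ₁ t, weight τ₂ t) := rfl
  refine ⟨?_, ?_⟩
  · rw [heq]
    exact (Complex.continuous_ofReal.comp (hw x)).continuousOn.mul hcomp
  · obtain ⟨C, hC⟩ := (isCompact_Icc.prod isCompact_Icc).exists_bound_of_continuousOn hH
    have hC0 : 0 ≤ C := (norm_nonneg _).trans (hC (0, 0) (by simp))
    refine ⟨C, min (x 0) (x 1), lt_min (hx 0) (hx 1), fun a b ha hb => ?_⟩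
    have hb' : ‖H (weight τ₁ (a, b), weight τ₂ (a, b))‖ ≤ C := hC _ (hmaps ⟨ha, hb⟩)
    have hwx : ‖(weight x (a, b) : ℂ)‖ ≤
        Real.exp (-min (x 0) (x 1) * a) * Real.exp (-min (x 0) (x 1) * b) := by
      rw [Complex.norm_real, Real.norm_eq_abs, weight, Real.abs_exp, ← Real.exp_add,
        Real.exp_le_exp]
      nlinarith [min_le_left (x 0) (x 1), min_le_right (x 0) (x 1)]
    rw [heq, norm_mul, mul_comm]
    exact mul_le_mul hb' hwx (norm_nonneg _) hC0

/-- The coordinates of the lattice point `x + m τ₁ + n τ₂`. -/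
def latticePoint (x τ₁ τ₂ : Fin 2 → ℝ) (p : ℕ × ℕ) (i : Fin 2) : ℝ :=
  x i + p.1 * τ₁ i + p.2 * τ₂ i

theorem latticePoint_pos (hx : ∀ i, 0 < x i) (h₁ : ∀ i, 0 < τ₁ i) (h₂ : ∀ i, 0 < τ₂ i)
    (p : ℕ × ℕ) (i : Fin 2) : 0 < latticePoint x τ₁ τ₂ p i := by
  have := hx i
  have := h₁ i
  have := h₂ i
  unfold latticePoint
  positivity

/-- Both coordinates are at least `c (1 + m + n)`, and `(1 + m + n)² ≥ (m + 1)(n + 1)`, so the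
double series is dominated by a product of two convergent series. -/
theorem summable_latticePoint (hx : ∀ i, 0 < x i) (h₁ : ∀ i, 0 < τ₁ i) (h₂ : ∀ i, 0 < τ₂ i)
    {σ : ℝ} (hσ : 1 < σ) :
    Summable fun p : ℕ × ℕ =>
      (latticePoint x τ₁ τ₂ p 0 * latticePoint x τ₁ τ₂ p 1) ^ (-σ) := by
  obtain ⟨c, hc, hcx, hc₁, hc₂⟩ : ∃ c : ℝ, 0 < c ∧ (∀ i, c ≤ x i) ∧ (∀ i, c ≤ τ₁ i) ∧
      ∀ i, c ≤ τ₂ i := by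
    have hex : ∀ u : Fin 2 → ℝ, (∀ i, 0 < u i) → ∃ c : ℝ, 0 < c ∧ ∀ i, c ≤ u i := fun u hu =>
      ⟨min (u 0) (u 1), lt_min (hu 0) (hu 1), fun i => by fin_cases i <;> simp⟩
    obtain ⟨c₀, hc₀, h₀⟩ := hex x hx
    obtain ⟨c₁, hc₁, h₁⟩ := hex τ₁ h₁
    obtain ⟨c₂, hc₂, h₂⟩ := hex τ₂ h₂
    exact ⟨min c₀ (min c₁ c₂), lt_min hc₀ (lt_min hc₁ hc₂),
      fun i => (min_le_left _ _).trans (h₀ i),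
      fun i => (min_le_right _ _).trans ((min_le_left _ _).trans (h₁ i)),
      fun i => (min_le_right _ _).trans ((min_le_right _ _).trans (h₂ i))⟩
  have hs : Summable fun n : ℕ => ((n : ℝ) + 1) ^ (-σ) := by
    have := (summable_nat_add_iff 1).mpr (Real.summable_nat_rpow.mpr (by linarith : -σ < -1))
    simpa using this
  refine Summable.of_nonneg_of_le (fun p => ?_) (fun p => ?_)
    ((hs.mul_of_nonneg hs (fun _ => by positivity) fun _ => by positivity).mul_left
      ((c * c) ^ (-σ)))
  · exact Real.rpow_nonneg (mul_nonneg (latticePoint_pos hx h₁ h₂ p 0).le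
      (latticePoint_pos hx h₁ h₂ p 1).le) _
  · have hp1 : (0 : ℝ) ≤ p.1 := Nat.cast_nonneg _
    have hp2 : (0 : ℝ) ≤ p.2 := Nat.cast_nonneg _
    have hle : ∀ i, c * (1 + p.1 + p.2) ≤ latticePoint x τ₁ τ₂ p i := fun i => by
      unfold latticePoint
      nlinarith [hcx i, mul_le_mul_of_nonneg_left (hc₁ i) hp1,
        mul_le_mul_of_nonneg_left (hc₂ i) hp2]
    have hbase : (c * c) * (((p.1 : ℝ) + 1) * (p.2 + 1)) ≤
        latticePoint x τ₁ τ₂ p 0 * latticePoint x τ₁ τ₂ p 1 := by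
      calc (c * c) * (((p.1 : ℝ) + 1) * (p.2 + 1))
          ≤ (c * c) * ((1 + p.1 + p.2) * (1 + p.1 + p.2)) :=
            mul_le_mul_of_nonneg_left (by nlinarith) (by positivity)
        _ = (c * (1 + p.1 + p.2)) * (c * (1 + p.1 + p.2)) := by ring
        _ ≤ _ := mul_le_mul (hle 0) (hle 1) (by positivity) (latticePoint_pos hx h₁ h₂ p 0).le
    rw [← Real.mul_rpow (by positivity) (by positivity),
      ← Real.mul_rpow (by positivity) (by positivity)]
    exact Real.rpow_le_rpow_of_nonpos (by positivity) hbase (by linarith)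

theorem norm_dirichletTerm (hx : ∀ i, 0 < x i) (h₁ : ∀ i, 0 < τ₁ i) (h₂ : ∀ i, 0 < τ₂ i)
    (hζ₁ : ‖ζ₁‖ = 1) (hζ₂ : ‖ζ₂‖ = 1) (s : ℂ) (p : ℕ × ℕ) :
    ‖ζ₁ ^ p.1 * ζ₂ ^ p.2 /
      ((latticePoint x τ₁ τ₂ p 0 * latticePoint x τ₁ τ₂ p 1 : ℝ) : ℂ) ^ s‖ =
    (latticePoint x τ₁ τ₂ p 0 * latticePoint x τ₁ τ₂ p 1) ^ (-s.re) := by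
  have hpos := mul_pos (latticePoint_pos hx h₁ h₂ p 0) (latticePoint_pos hx h₁ h₂ p 1)
  rw [norm_div, norm_mul, norm_pow, norm_pow, hζ₁, hζ₂, one_pow, one_pow, one_mul,
    Complex.norm_cpow_eq_rpow_re_of_pos hpos, Real.rpow_neg hpos.le, one_div]

theorem mellinKernel_exponential (u : Fin 2 → ℝ) (z s : ℂ) (t : ℝ × ℝ) :
    mellinKernel (fun t => z * weight u t) s s t =
      z * (((t.1 : ℂ) ^ (s - 1) * Complex.exp (-((u 0 : ℂ) * t.1))) *
        ((t.2 : ℂ) ^ (s - 1) * Complex.exp (-((u 1 : ℂ) * t.2)))) := by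
  rw [mellinKernel, weight, neg_add, Real.exp_add]
  push_cast
  ring

theorem integrable_cpow_mul_exp {r : ℝ} (hr : 0 < r) {s : ℂ} (hs : 0 < s.re) :
    Integrable (fun a : ℝ => (a : ℂ) ^ (s - 1) * Complex.exp (-((r : ℂ) * a)))
      (volume.restrict (Ioi 0)) := by
  refine Integrable.mono' (integrableOn_rpow_mul_exp hs hr) ?_ ?_
  · refine ContinuousOn.aestronglyMeasurable ?_ measurableSet_Ioi
    refine ContinuousOn.mul ?_ (by fun_prop)
    exact ContinuousOn.cpow_const (by fun_prop) fun t ht => Or.inl (by simpa using ht)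
  · filter_upwards [ae_restrict_mem measurableSet_Ioi] with a ha
    rw [norm_mul, Complex.norm_cpow_eq_rpow_re_of_pos ha, Complex.norm_exp]
    simp

theorem doubleMellin_exponential {u : Fin 2 → ℝ} (hu : ∀ i, 0 < u i) (z : ℂ) {s : ℂ}
    (hs : 0 < s.re) :
    doubleMellin (fun t => z * weight u t) s s =
      Complex.Gamma s ^ 2 * (z / ((u 0 * u 1 : ℝ) : ℂ) ^ s) := by
  simp only [doubleMellin, mellinKernel_exponential, quadrant]
  rw [integral_const_mul, integral_prod_mul (fun a : ℝ => (a : ℂ) ^ (s - 1) *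
    Complex.exp (-((u 0 : ℂ) * a))) (fun b : ℝ => (b : ℂ) ^ (s - 1) *
    Complex.exp (-((u 1 : ℂ) * b))), Complex.integral_cpow_mul_exp_neg_mul_Ioi hs (hu 0),
    Complex.integral_cpow_mul_exp_neg_mul_Ioi hs (hu 1), Complex.ofReal_mul,
    Complex.mul_cpow_ofReal_nonneg (hu 0).le (hu 1).le]
  have hinv : ∀ i, (1 / (u i : ℂ)) ^ s = ((u i : ℂ) ^ s)⁻¹ := fun i => by
    rw [one_div, Complex.inv_cpow]
    rw [Complex.arg_ofReal_of_nonneg (hu i).le]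
    exact Real.pi_pos.ne
  rw [hinv, hinv, div_eq_mul_inv, mul_inv]
  ring

theorem integral_norm_mellinKernel_exponential {u : Fin 2 → ℝ} (hu : ∀ i, 0 < u i) {z : ℂ}
    (hz : ‖z‖ = 1) {s : ℂ} (hs : 0 < s.re) :
    ∫ t, ‖mellinKernel (fun t => z * weight u t) s s t‖ ∂quadrant =
      Real.Gamma s.re ^ 2 * (u 0 * u 1) ^ (-s.re) := by
  have hae : ∀ᵐ t ∂quadrant, ‖mellinKernel (fun t => z * weight u t) s s t‖ =
      (t.1 ^ (s.re - 1) * Real.exp (-(u 0 * t.1))) *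
        (t.2 ^ (s.re - 1) * Real.exp (-(u 1 * t.2))) := by
    refine ae_quadrant fun a b ha hb => ?_
    rw [mellinKernel_exponential, norm_mul, hz, one_mul, norm_mul, norm_mul, norm_mul,
      Complex.norm_cpow_eq_rpow_re_of_pos ha, Complex.norm_cpow_eq_rpow_re_of_pos hb,
      Complex.norm_exp, Complex.norm_exp]
    simp
  rw [integral_congr_ae hae, quadrant, integral_prod_mul (fun a : ℝ => a ^ (s.re - 1) *
    Real.exp (-(u 0 * a))) (fun b : ℝ => b ^ (s.re - 1) * Real.exp (-(u 1 * b))),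
    Real.integral_rpow_mul_exp_neg_mul_Ioi hs (hu 0),
    Real.integral_rpow_mul_exp_neg_mul_Ioi hs (hu 1), Real.mul_rpow (hu 0).le (hu 1).le,
    one_div, one_div, Real.inv_rpow (hu 0).le, Real.inv_rpow (hu 1).le, Real.rpow_neg (hu 0).le,
    Real.rpow_neg (hu 1).le]
  ring

/-- A product of two geometric series; the point is in the open quadrant so that both ratios have
norm below `1`. -/
theorem tsum_mul_weight_latticePoint (h₁ : ∀ i, 0 < τ₁ i) (h₂ : ∀ i, 0 < τ₂ i)
    (hζ₁ : ‖ζ₁‖ = 1) (hζ₂ : ‖ζ₂‖ = 1) {a b : ℝ} (ha : 0 < a) (hb : 0 < b) :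
    ∑' p : ℕ × ℕ, ζ₁ ^ p.1 * ζ₂ ^ p.2 * (weight (latticePoint x τ₁ τ₂ p) (a, b) : ℂ) =
      exponentialSum x τ₁ τ₂ ζ₁ ζ₂ (MvPolynomial.X 0 * MvPolynomial.X 1) (a, b) := by
  have hlt : ∀ {ζ : ℂ} {τ : Fin 2 → ℝ}, ‖ζ‖ = 1 → (∀ i, 0 < τ i) →
      ‖ζ * weight τ (a, b)‖ < 1 := by
    intro ζ τ hζ hτ
    rw [norm_mul, hζ, one_mul, Complex.norm_real, Real.norm_eq_abs, weight, Real.abs_exp]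
    exact weight_lt_one hτ ha hb
  have hterm : ∀ p : ℕ × ℕ, ζ₁ ^ p.1 * ζ₂ ^ p.2 * (weight (latticePoint x τ₁ τ₂ p) (a, b) : ℂ) =
      weight x (a, b) * ((ζ₁ * weight τ₁ (a, b)) ^ p.1 * (ζ₂ * weight τ₂ (a, b)) ^ p.2) := by
    intro p
    have : weight (latticePoint x τ₁ τ₂ p) (a, b) =
        weight x (a, b) * (weight τ₁ (a, b) ^ p.1 * weight τ₂ (a, b) ^ p.2) := by
      simp only [weight, latticePoint, ← Real.exp_nat_mul, ← Real.exp_add]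
      congr 1
      ring
    rw [this]
    push_cast
    ring
  simp only [hterm]
  rw [tsum_mul_left, ← tsum_mul_tsum_of_summable_norm
    (summable_norm_geometric_of_norm_lt_one (hlt hζ₁ h₁))
    (summable_norm_geometric_of_norm_lt_one (hlt hζ₂ h₂)),
    tsum_geometric_of_norm_lt_one (hlt hζ₁ h₁), tsum_geometric_of_norm_lt_one (hlt hζ₂ h₂)]
  simp [exponentialSum]

/-- Sum and integral may be exchanged because the `L¹` norms of the terms are `Γ(σ)²` times the
terms of `summable_latticePoint`, with `σ = Re s > 1`. -/
theorem hasSum_doubleMellin (hx : ∀ i, 0 < x i) (h₁ : ∀ i, 0 < τ₁ i) (h₂ : ∀ i, 0 < τ₂ i)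
    (hζ₁ : ‖ζ₁‖ = 1) (hζ₂ : ‖ζ₂‖ = 1) {s : ℂ} (hs : 1 < s.re) :
    HasSum (fun p : ℕ × ℕ => Complex.Gamma s ^ 2 * (ζ₁ ^ p.1 * ζ₂ ^ p.2 /
      ((latticePoint x τ₁ τ₂ p 0 * latticePoint x τ₁ τ₂ p 1 : ℝ) : ℂ) ^ s))
      (doubleMellin (exponentialSum x τ₁ τ₂ ζ₁ ζ₂ (MvPolynomial.X 0 * MvPolynomial.X 1)) s s) := by
  have hs0 : 0 < s.re := by linarith
  have hu := latticePoint_pos hx h₁ h₂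
  have hz : ∀ p : ℕ × ℕ, ‖ζ₁ ^ p.1 * ζ₂ ^ p.2‖ = 1 := fun p => by
    rw [norm_mul, norm_pow, norm_pow, hζ₁, hζ₂, one_pow, one_pow, one_mul]
  have h := hasSum_integral_of_summable_integral_norm (μ := quadrant)
    (F := fun (p : ℕ × ℕ) => mellinKernel
      (fun t => ζ₁ ^ p.1 * ζ₂ ^ p.2 * weight (latticePoint x τ₁ τ₂ p) t) s s) ?_ ?_
  · have hint : ∫ t, ∑' p : ℕ × ℕ, mellinKernel
        (fun t => ζ₁ ^ p.1 * ζ₂ ^ p.2 * weight (latticePoint x τ₁ τ₂ p) t) s s t ∂quadrant =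
        doubleMellin (exponentialSum x τ₁ τ₂ ζ₁ ζ₂ (MvPolynomial.X 0 * MvPolynomial.X 1)) s s := by
      refine integral_congr_ae (ae_quadrant fun a b ha hb => ?_)
      simp only [mellinKernel]
      rw [tsum_mul_left, tsum_mul_weight_latticePoint h₁ h₂ hζ₁ hζ₂ ha hb]
    rw [hint] at h
    exact h.congr_fun fun p => (doubleMellin_exponential (hu p) _ hs0).symm
  · intro p
    rw [funext (mellinKernel_exponential _ _ s)]
    exact ((integrable_cpow_mul_exp (hu p 0) hs0).mul_prod
      (integrable_cpow_mul_exp (hu p 1) hs0)).const_mul _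
  · simp only [fun p => integral_norm_mellinKernel_exponential (hu p) (hz p) hs0]
    exact (summable_latticePoint hx h₁ h₂ hs).mul_left _

end ExponentialSeries

/-! ### Real embeddings, the norm, and rationality of the composite operator. -/

section RealQuadratic

theorem bijective_ofRealHom_comp {k : Type*} [Field k] [IsTotallyReal k] :
    Function.Bijective fun σ : k →+* ℝ => Complex.ofRealHom.comp σ := by
  refine ⟨fun σ τ h => RingHom.ext fun x => Complex.ofReal_injective (RingHom.congr_fun h x),
    fun φ => ?_⟩
  have hφ := IsTotallyReal.complexEmbedding_isReal φ
  exact ⟨hφ.embedding, RingHom.ext fun x => hφ.coe_embedding_apply x⟩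

variable {k : Type*} [Field k] [NumberField k]

theorem norm_eq_prod_real_embeddings [IsTotallyReal k] (a : k) :
    (Algebra.norm ℚ a : ℝ) = ∏ σ : k →+* ℝ, σ a := by
  apply Complex.ofReal_injective
  have h := Algebra.norm_eq_prod_embeddings ℚ ℂ a
  rw [Complex.ofReal_prod]
  calc ((Algebra.norm ℚ a : ℝ) : ℂ) = algebraMap ℚ ℂ (Algebra.norm ℚ a) := by simp
    _ = ∏ σ : k →ₐ[ℚ] ℂ, σ a := h
    _ = ∏ φ : k →+* ℂ, φ a :=
        (Fintype.prod_equiv (RingHom.equivRatAlgHom k ℂ) (fun φ : k →+* ℂ => φ a) (fun σ => σ a)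
          fun _ => rfl).symm
    _ = ∏ σ : k →+* ℝ, (σ a : ℂ) :=
        (Fintype.prod_bijective _ bijective_ofRealHom_comp (fun σ : k →+* ℝ => (σ a : ℂ))
          (fun φ => φ a) fun _ => rfl).symm

theorem card_real_embeddings [IsTotallyReal k] [Algebra.IsQuadraticExtension ℚ k] :
    Fintype.card (k →+* ℝ) = 2 := by
  rw [Fintype.card_of_bijective bijective_ofRealHom_comp, Embeddings.card k ℂ,
    Algebra.IsQuadraticExtension.finrank_eq_two]

theorem prod_real_embeddings [IsTotallyReal k] [Algebra.IsQuadraticExtension ℚ k]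
    {ι : Fin 2 → k →+* ℝ} (hι : Function.Injective ι) (a : k) :
    ∏ σ : k →+* ℝ, σ a = ι 0 a * ι 1 a := by
  have hbij : Function.Bijective ι :=
    (Fintype.bijective_iff_injective_and_card ι).mpr ⟨hι, by simp [card_real_embeddings]⟩
  rw [← Fintype.prod_bijective ι hbij (fun i => ι i a) (fun σ => σ a) fun _ => rfl,
    Fin.prod_univ_two]

theorem norm_eq_mul [IsTotallyReal k] [Algebra.IsQuadraticExtension ℚ k]
    {ι : Fin 2 → k →+* ℝ} (hι : Function.Injective ι) (a : k) :
    (Algebra.norm ℚ a : ℝ) = ι 0 a * ι 1 a := by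
  rw [norm_eq_prod_real_embeddings, prod_real_embeddings hι]

theorem exists_injective_embeddings [IsTotallyReal k] [Algebra.IsQuadraticExtension ℚ k] :
    ∃ ι : Fin 2 → k →+* ℝ, Function.Injective ι :=
  ⟨_, (Fintype.equivFinOfCardEq (card_real_embeddings (k := k))).symm.injective⟩

/-- The polar form of the norm of a quadratic field. -/
def normPolar (a b : k) : ℚ := Algebra.norm ℚ (a + b) - Algebra.norm ℚ a - Algebra.norm ℚ b

/-- The operator over `ℚ` whose base change to `ℂ` is the composite of the two Euler operators
attached to the real embeddings. -/
def normOp (a t₁ t₂ : k) : MvPolynomial (Fin 2) ℚ → MvPolynomial (Fin 2) ℚ :=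
  quadraticOp (Algebra.norm ℚ a) (normPolar a t₁) (normPolar a t₂) (Algebra.norm ℚ t₁)
    (normPolar t₁ t₂) (Algebra.norm ℚ t₂)

/-- With `N(b) = σ(b) σ'(b)`, the polar form is `σ(b) σ'(c) + σ(c) σ'(b)`: these are exactly the
coefficients in `eulerOp_eulerOp`. -/
theorem map_normOp {σ σ' : k →+* ℝ} (h : ∀ a : k, (Algebra.norm ℚ a : ℝ) = σ a * σ' a)
    (a t₁ t₂ : k) (P : MvPolynomial (Fin 2) ℚ) :
    MvPolynomial.map (algebraMap ℚ ℂ) (normOp a t₁ t₂ P) =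
      eulerOp (σ a : ℂ) (σ t₁ : ℂ) (σ t₂ : ℂ)
        (eulerOp (σ' a : ℂ) (σ' t₁ : ℂ) (σ' t₂ : ℂ) (MvPolynomial.map (algebraMap ℚ ℂ) P)) := by
  have hN : ∀ b : k, algebraMap ℚ ℂ (Algebra.norm ℚ b) = (σ b : ℂ) * σ' b := fun b => by
    rw [← Complex.ofReal_mul, ← h b]
    simp
  have hP : ∀ b c : k, algebraMap ℚ ℂ (normPolar b c) = (σ b : ℂ) * σ' c + σ c * σ' b :=
    fun b c => by
      rw [normPolar, map_sub, map_sub, hN, hN, hN, map_add, map_add]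
      push_cast
      ring
  rw [normOp, map_quadraticOp, eulerOp_eulerOp, hN, hN, hN, hP, hP, hP]

theorem map_iterate_normOp {σ σ' : k →+* ℝ} (h : ∀ a : k, (Algebra.norm ℚ a : ℝ) = σ a * σ' a)
    (a t₁ t₂ : k) (P : MvPolynomial (Fin 2) ℚ) (n : ℕ) :
    MvPolynomial.map (algebraMap ℚ ℂ) ((normOp a t₁ t₂)^[n] P) =
      (eulerOp (σ a : ℂ) (σ t₁ : ℂ) (σ t₂ : ℂ) ∘
        eulerOp (σ' a : ℂ) (σ' t₁ : ℂ) (σ' t₂ : ℂ))^[n] (MvPolynomial.map (algebraMap ℚ ℂ) P) := by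
  induction n with
  | zero => rfl
  | succ n ih =>
    rw [Function.iterate_succ_apply', Function.iterate_succ_apply', map_normOp h, ih,
      Function.comp_apply]

theorem IsTotallyPos.parallelogram {t₁ t₂ a : k} (h₁ : IsTotallyPos t₁) (h₂ : IsTotallyPos t₂)
    (ha : a ∈ parallelogram t₁ t₂) : IsTotallyPos a := by
  obtain ⟨l, m, hl, -, hm, -, rfl⟩ := ha
  intro σ
  have hl' : (0 : ℝ) < l := by exact_mod_cast hl
  have hm' : (0 : ℝ) ≤ m := by exact_mod_cast hm
  simp only [Algebra.smul_def, map_add, map_mul, eq_ratCast, map_ratCast]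
  exact add_pos_of_pos_of_nonneg (mul_pos hl' (h₁ σ)) (mul_nonneg hm' (h₂ σ).le)

end RealQuadratic

/-! ### Parametrisation of a class in the cone by pairs of natural numbers. -/

section Cones

variable {k : Type*} [Field k] [NumberField k] [Algebra.IsQuadraticExtension ℚ k]
  {J : Submodule (𝓞 k) k} (τ₁ τ₂ : J)

theorem representative_spec (hτ : LinearIndependent ℚ ![(τ₁ : k), (τ₂ : k)])
    (A : J ⧸ lattice τ₁ τ₂) :
    (QuotientAddGroup.mk (representative τ₁ τ₂ A) : J ⧸ lattice τ₁ τ₂) = A ∧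
      (representative τ₁ τ₂ A : k) ∈ parallelogram (τ₁ : k) (τ₂ : k) :=
  Classical.epsilon_spec (existsUnique_representative τ₁ τ₂ hτ A).exists

theorem add_nsmul_mem_coneClass (hτ : LinearIndependent ℚ ![(τ₁ : k), (τ₂ : k)])
    (A : J ⧸ lattice τ₁ τ₂) (p : ℕ × ℕ) :
    representative τ₁ τ₂ A + p.1 • τ₁ + p.2 • τ₂ ∈ coneClass τ₁ τ₂ A := by
  obtain ⟨hA, l, m, hl, -, hm, -, ha⟩ := representative_spec τ₁ τ₂ hτ A
  refine ⟨?_, l + p.1, m + p.2, by positivity, by positivity, ?_⟩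
  · refine Eq.trans (Eq.symm ?_) hA
    rw [QuotientAddGroup.eq, add_assoc, neg_add_cancel_left]
    exact AddSubgroup.add_mem_sup (AddSubgroup.nsmul_mem _ (AddSubgroup.mem_zmultiples _) _)
      (AddSubgroup.nsmul_mem _ (AddSubgroup.mem_zmultiples _) _)
  · push_cast
    rw [ha]
    simp only [← Nat.cast_smul_eq_nsmul ℚ, Algebra.smul_def, map_add, map_natCast]
    ring

theorem bijective_coneClass (hτ : LinearIndependent ℚ ![(τ₁ : k), (τ₂ : k)])
    (A : J ⧸ lattice τ₁ τ₂) :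
    Function.Bijective fun p : ℕ × ℕ =>
      (⟨representative τ₁ τ₂ A + p.1 • τ₁ + p.2 • τ₂, add_nsmul_mem_coneClass τ₁ τ₂ hτ A p⟩ :
        coneClass τ₁ τ₂ A) := by
  have hinj : ∀ l m : ℚ, l • (τ₁ : k) + m • (τ₂ : k) = 0 → l = 0 ∧ m = 0 :=
    LinearIndependent.pair_iff.mp hτ
  constructor
  · intro p q hpq
    have h := congrArg (fun a : coneClass τ₁ τ₂ A => ((a : J) : k)) hpq
    push_cast at h
    obtain ⟨h1, h2⟩ := hinj (p.1 - q.1) (p.2 - q.2) (by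
      simp only [Algebra.smul_def, map_sub, map_natCast] at h ⊢
      linear_combination h)
    exact Prod.ext (by exact_mod_cast sub_eq_zero.mp h1) (by exact_mod_cast sub_eq_zero.mp h2)
  · rintro ⟨y, hy, l', m', hl', hm', hy'⟩
    obtain ⟨hA, l, m, hl, hl1, hm, hm1, ha⟩ := representative_spec τ₁ τ₂ hτ A
    replace hy := hA.trans hy.symm
    rw [QuotientAddGroup.eq, lattice, AddSubgroup.mem_sup] at hy
    obtain ⟨u, hu, v, hv, huv⟩ := hy
    obtain ⟨p, rfl⟩ := AddSubgroup.mem_zmultiples_iff.mp hu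
    obtain ⟨q, rfl⟩ := AddSubgroup.mem_zmultiples_iff.mp hv
    have hyx : y = representative τ₁ τ₂ A + p • τ₁ + q • τ₂ := by
      rw [add_assoc, huv]; abel
    have hk : (y : k) = (representative τ₁ τ₂ A : k) + p • (τ₁ : k) + q • (τ₂ : k) := by
      rw [hyx]; push_cast; rfl
    obtain ⟨e1, e2⟩ := hinj (l + p - l') (m + q - m') (by
      rw [hy', ha] at hk
      simp only [Algebra.smul_def, map_add, map_sub, map_intCast] at hk ⊢
      linear_combination -hk)
    -- The representative has coordinates in `(0,1] × [0,1)`. From `l ≤ 1` and `l + p > 0` follows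
    -- `p > -1`; from `m < 1` and `m + q ≥ 0` follows `q > -1`.
    have hp : 0 ≤ p := by
      have : (-1 : ℚ) < p := by linarith
      have : -1 < p := by exact_mod_cast this
      omega
    have hq : 0 ≤ q := by
      have : (-1 : ℚ) < q := by linarith
      have : -1 < q := by exact_mod_cast this
      omega
    lift p to ℕ using hp
    lift q to ℕ using hq
    refine ⟨(p, q), Subtype.ext ?_⟩
    simp only [hyx, natCast_zsmul]

end Cones

/-! ### Values of the character and the field `ℚ(μ_f)`. -/

section Cyclotomic

variable {k : Type*} [Field k] {𝔣 : Ideal (𝓞 k)} {f : ℕ}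
  {I : FractionalIdeal (nonZeroDivisors (𝓞 k)) k} {ξ : AddChar (I : Submodule (𝓞 k) k) ℂ}

/-- The integer `f` lies in `𝔣`, which annihilates `ξ`. -/
theorem IsCharacterPair.pow_eq_one
    (hf𝔣 : 𝔣.comap (algebraMap ℤ (𝓞 k)) = Ideal.span {(f : ℤ)})
    (hξ : IsCharacterPair 𝔣 I ξ) (a : (I : Submodule (𝓞 k) k)) : ξ a ^ f = 1 := by
  have hmem : (f : ℤ) ∈ 𝔣.comap (algebraMap ℤ (𝓞 k)) := by
    rw [hf𝔣]; exact Ideal.mem_span_singleton_self _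
  rw [Ideal.mem_comap, map_natCast, ← hξ.annihilator_eq] at hmem
  have h : ξ ((f : 𝓞 k) • a) = 1 := hmem a
  rwa [Nat.cast_smul_eq_nsmul, AddChar.map_nsmul_eq_pow] at h

theorem IsCharacterPair.mem_cyclotomicSubfield
    (hf𝔣 : 𝔣.comap (algebraMap ℤ (𝓞 k)) = Ideal.span {(f : ℤ)})
    (hξ : IsCharacterPair 𝔣 I ξ) (a : (I : Submodule (𝓞 k) k)) : ξ a ∈ cyclotomicSubfield f :=
  IntermediateField.subset_adjoin _ _ (hξ.pow_eq_one hf𝔣 a)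

theorem eval_map_mem {K : IntermediateField ℚ ℂ} {v : Fin 2 → ℂ} (hv : ∀ i, v i ∈ K)
    (Q : MvPolynomial (Fin 2) ℚ) :
    MvPolynomial.eval v (MvPolynomial.map (algebraMap ℚ ℂ) Q) ∈ K := by
  induction Q using MvPolynomial.induction_on with
  | C q => simp
  | add p q hp hq => simpa only [map_add] using K.add_mem hp hq
  | mul_X p i hp => simpa using K.mul_mem hp (hv i)

end Cyclotomic

theorem coneSeries_eq {k : Type*} [Field k] [CharZero k] {J : Submodule (𝓞 k) k}
    (ι : Fin 2 → k →+* ℝ) (ξ : AddChar J ℂ) (τ₁ τ₂ : J) (A : J ⧸ lattice τ₁ τ₂) :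
    coneSeries ι ξ τ₁ τ₂ A = MvPowerSeries.C (ξ (representative τ₁ τ₂ A)) *
      formalSum (fun i => ι i (representative τ₁ τ₂ A : k)) (fun i => ι i (τ₁ : k))
        (fun i => ι i (τ₂ : k)) (ξ τ₁) (ξ τ₂) (MvPolynomial.X 0 * MvPolynomial.X 1) := by
  rw [coneSeries, formalSum, map_mul, MvPolynomial.aeval_X, MvPolynomial.aeval_X,
    MvPowerSeries.mul_inv_rev, mul_assoc]
  simp only [geomSeries, Matrix.cons_val_zero, Matrix.cons_val_one]
  rw [mul_comm (_⁻¹ : MvPowerSeries (Fin 2) ℂ)]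

end ConeZeta

end

/-! ### Assembly of the theorem. -/

open ConeZeta in
theorem theorem3 {k : Type*} [Field k] [NumberField k] [Algebra.IsQuadraticExtension ℚ k]
    [NumberField.IsTotallyReal k]
    (𝔣 : Ideal (𝓞 k)) (h𝔣 : 𝔣 ≠ ⊤)
    (f : ℕ) (hf : 0 < f) (hf𝔣 : 𝔣.comap (algebraMap ℤ (𝓞 k)) = Ideal.span {(f : ℤ)})
    (I : FractionalIdeal (nonZeroDivisors (𝓞 k)) k)
    (ξ : AddChar (I : Submodule (𝓞 k) k) ℂ) (hξ : ConeZeta.IsCharacterPair 𝔣 I ξ)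
    (τ₁ τ₂ : (I : Submodule (𝓞 k) k))
    (hτ : LinearIndependent ℚ ![(τ₁ : k), (τ₂ : k)])
    (hpos₁ : ConeZeta.IsTotallyPos (τ₁ : k)) (hpos₂ : ConeZeta.IsTotallyPos (τ₂ : k))
    (hker₁ : ξ τ₁ ≠ 1) (hker₂ : ξ τ₂ ≠ 1)
    (A : (I : Submodule (𝓞 k) k) ⧸ ConeZeta.lattice τ₁ τ₂) :
    (∀ s : ℂ, 1 < s.re →
      Summable fun a : ConeZeta.coneClass τ₁ τ₂ A => ‖ConeZeta.zetaTerm ξ s a‖) ∧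
    ∃ Z : ℂ → ℂ,
      Meromorphic Z ∧
      AnalyticOnNhd ℂ Z {s : ℂ | 1 < s.re} ∧
      (∀ s : ℂ, 1 < s.re → Z s = ConeZeta.coneZeta ξ τ₁ τ₂ A s) ∧
      ∀ n : ℕ,
        AnalyticAt ℂ Z (-(n : ℂ)) ∧
        (∀ ι : Fin 2 → k →+* ℝ, Function.Injective ι →
          Z (-(n : ℂ)) = MvPowerSeries.constantCoeff
            (ConeZeta.Delta^[n] (ConeZeta.coneSeries ι ξ τ₁ τ₂ A))) ∧
        Z (-(n : ℂ)) ∈ ConeZeta.cyclotomicSubfield f := by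
  classical
  obtain ⟨ι₀, hι₀⟩ := exists_injective_embeddings (k := k)
  set α := representative τ₁ τ₂ A
  have hpos : IsTotallyPos (α : k) :=
    hpos₁.parallelogram hpos₂ (representative_spec τ₁ τ₂ hτ A).2
  have hf0 : f ≠ 0 := hf.ne'
  have hn : ∀ a, ‖ξ a‖ = 1 := fun a => Complex.norm_eq_one_of_pow_eq_one (hξ.pow_eq_one hf𝔣 a) hf0
  let e := Equiv.ofBijective _ (bijective_coneClass τ₁ τ₂ hτ A)
  have hterm : ∀ (s : ℂ) (p : ℕ × ℕ), zetaTerm ξ s (e p) =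
      ξ α * (ξ τ₁ ^ p.1 * ξ τ₂ ^ p.2 /
        ((latticePoint (fun i => ι₀ i (α : k)) (fun i => ι₀ i (τ₁ : k)) (fun i => ι₀ i (τ₂ : k)) p 0 *
          latticePoint (fun i => ι₀ i (α : k)) (fun i => ι₀ i (τ₁ : k)) (fun i => ι₀ i (τ₂ : k)) p 1
            : ℝ) : ℂ) ^ s) := by
    intro s p
    have he : ((e p : coneClass τ₁ τ₂ A) : (I : Submodule (𝓞 k) k)) =
      α + p.1 • τ₁ + p.2 • τ₂ := rfl
    rw [zetaTerm, prod_real_embeddings hι₀, he]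
    simp only [AddChar.map_add_eq_mul, AddChar.map_nsmul_eq_pow, latticePoint]
    push_cast
    simp only [map_add, nsmul_eq_mul, map_mul, map_natCast]
    push_cast
    ring
  -- These polynomials come from `ℚ` and are defined through norms alone, so they involve no choice
  -- of embeddings. The start `X₀ X₁` stands for the product of the two geometric series.
  let P : ℕ → MvPolynomial (Fin 2) ℂ := fun n => MvPolynomial.map (algebraMap ℚ ℂ)
    ((normOp (α : k) (τ₁ : k) (τ₂ : k))^[n] (MvPolynomial.X 0 * MvPolynomial.X 1))
  have hP0 : P 0 = MvPolynomial.X 0 * MvPolynomial.X 1 := by simp [P]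
  let v : Fin 2 → ℂ := ![(1 - ξ τ₁)⁻¹, (1 - ξ τ₂)⁻¹]
  obtain ⟨Z, hZd, hZ, hZv⟩ := exists_entire_mellin
    (φ := fun n => exponentialSum (fun i => ι₀ i (α : k)) (fun i => ι₀ i (τ₁ : k))
      (fun i => ι₀ i (τ₂ : k)) (ξ τ₁) (ξ τ₂) (P n))
    (ψ := fun n => exponentialSum (fun i => ι₀ i (α : k)) (fun i => ι₀ i (τ₁ : k))
      (fun i => ι₀ i (τ₂ : k)) (ξ τ₁) (ξ τ₂)
      (eulerOp (ι₀ 0 (α : k) : ℂ) (ι₀ 0 (τ₁ : k) : ℂ) (ι₀ 0 (τ₂ : k) : ℂ) (P n)))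
    (fun n => hasExpDecay_exponentialSum (fun i => hpos _) (fun i => hpos₁ _) (fun i => hpos₂ _)
      (hn _) hker₁ (hn _) hker₂ _)
    (fun n => hasExpDecay_exponentialSum (fun i => hpos _) (fun i => hpos₁ _) (fun i => hpos₂ _)
      (hn _) hker₁ (hn _) hker₂ _)
    (fun n a b ha hb => hasDerivAt_exponentialSum_left (fun i => hpos₁ _) (fun i => hpos₂ _)
      (hn _) hker₁ (hn _) hker₂ _ ha hb)
    (fun n a b ha hb => by
      -- The derivative in the first variable is taken first, so the operator of `ι₀ 0` is the inner
      -- one; this is why the norm is factored in the reverse order.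
      have hstep : P (n + 1) = eulerOp (ι₀ 1 (α : k) : ℂ) (ι₀ 1 (τ₁ : k) : ℂ) (ι₀ 1 (τ₂ : k) : ℂ)
          (eulerOp (ι₀ 0 (α : k) : ℂ) (ι₀ 0 (τ₁ : k) : ℂ) (ι₀ 0 (τ₂ : k) : ℂ) (P n)) := by
        simp only [P, Function.iterate_succ_apply']
        exact map_normOp (fun a => (norm_eq_mul hι₀ a).trans (mul_comm _ _)) _ _ _ _
      rw [hstep]
      exact hasDerivAt_exponentialSum_right (fun i => hpos₁ _) (fun i => hpos₂ _)
        (hn _) hker₁ (hn _) hker₂ _ ha hb)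
  have hval : ∀ n : ℕ, ξ α * Z (-n) = ξ α * MvPolynomial.eval v (P n) := fun n => by
    rw [hZv n, exponentialSum_zero]
  have hdiff : Differentiable ℂ fun s => ξ α * Z s := hZd.const_mul _
  refine ⟨fun s hs => ?_, fun s => ξ α * Z s, fun s => (hdiff.analyticAt s).meromorphicAt,
    fun s _ => hdiff.analyticAt s, fun s hs => ?_, fun n => ⟨hdiff.analyticAt _, fun ι hι => ?_, ?_⟩⟩
  · rw [← e.summable_iff]
    refine (summable_latticePoint (fun i => hpos (ι₀ i)) (fun i => hpos₁ (ι₀ i))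
      (fun i => hpos₂ (ι₀ i)) hs).congr fun p => ?_
    rw [Function.comp_apply, hterm, norm_mul, hn, one_mul,
      norm_dirichletTerm (fun i => hpos (ι₀ i)) (fun i => hpos₁ (ι₀ i)) (fun i => hpos₂ (ι₀ i))
        (hn _) (hn _)]
  · have hs' : (1 : ℝ) < s.re := hs
    have hG : Complex.Gamma s ^ 2 ≠ 0 :=
      pow_ne_zero 2 (Complex.Gamma_ne_zero_of_re_pos (by linarith))
    have hsum := (hasSum_doubleMellin (fun i => hpos (ι₀ i)) (fun i => hpos₁ (ι₀ i))
      (fun i => hpos₂ (ι₀ i)) (hn τ₁) (hn τ₂) hs').tsum_eq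
    have hZs := hZ s (by linarith)
    simp only [hP0] at hZs
    rw [← hZs, tsum_mul_left] at hsum
    rw [coneZeta, ← e.tsum_eq, tsum_congr (hterm s), tsum_mul_left, mul_left_cancel₀ hG hsum]
  · change ξ α * Z (-n) = _
    rw [hval, coneSeries_eq, iterate_Delta_formalSum _ _ _ hker₁ hker₂, map_mul,
      MvPowerSeries.constantCoeff_C, constantCoeff_formalSum]
    -- For an arbitrary ordering `ι`, the iterated Euler operators descend to the same iterates of
    -- `normOp`, so the constant term agrees with the value computed through `ι₀`.
    have h := map_iterate_normOp (norm_eq_mul hι) (α : k) (τ₁ : k) (τ₂ : k)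
      (MvPolynomial.X 0 * MvPolynomial.X 1) n
    rw [map_mul, MvPolynomial.map_X, MvPolynomial.map_X] at h
    rw [← h]
  · change ξ α * Z (-n) ∈ _
    rw [hval]
    have hmem := fun a => hξ.mem_cyclotomicSubfield hf𝔣 a
    refine mul_mem (hmem α) (eval_map_mem (fun i => ?_) _)
    fin_cases i
    · exact inv_mem (sub_mem (one_mem _) (hmem τ₁))
    · exact inv_mem (sub_mem (one_mem _) (hmem τ₂))
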